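/- Let $D=\partial_x\partial_y(\partial_x-\partial_y)$, $\vec u=(1,0)$, $\vec v=(0,1)$, $\vec w=(-1,1)$. For $X\subset\mathbb R^2$ let $\mathrm{Conv}_{\{\vec u,\vec v,\vec w\}}(X)$ be the smallest set $Y\supseteq X$ such that, for every $\vec e\in\{\vec u,\vec v,\vec w\}$, whenever $a,b\in Y$ and $a-b=t\vec e$ for some real $t$, the segment joining $a$ and $b$ is contained in $Y$. Let $$\mathcal A=\Big\{(p,q,r):\ p,q,r\in[2,4),\ \tfrac1p+\tfrac1q+\tfrac1r=\tfrac54\Big\}.$$ **Corollary.** For all constants $A,B,c>0$ and all $(p,q,r)\in\mathcal A$ there is a constant $C>0$, depending only on $A,B,c,p,q,r$, such that the following holds. Let $\delta_1,\delta_2,\mu>0$. Let $\phi:\mathbb R^2\to\mathbb C$ be smooth and compactly supported, and suppose that the support of $\phi$ has $x$-width at most $\delta_1$ and $y$-width at most $\delta_2$ (any two of its points on a common horizontal line are at distance at most $\delta_1$, and any two on a common vertical line at distance at most $\delta_2$). Suppose that for $l=1,2$, everywhere on $\mathbb R^2$, $$|\partial_x^l\phi|\le A\,\delta_1^{-l}\quad\text{and}\quad|\partial_y^l\phi|\le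 A\,\delta_2^{-l}.$$ Let $S$ be a real-valued smooth function on an open set containing $\mathrm{Conv}_{\{\vec u,\vec v,\vec w\}}(\mathrm{supp}\,\phi)$ such that for all $(x,y)\in \mathrm{Conv}_{\{\vec u,\vec v,\vec w\}}(\mathrm{supp}\,\phi)$ and $l=1,2$, $$|DS(x,y)|\ge c\,\mu,\qquad |\partial_x^l DS(x,y)|\le B\,\frac{\mu}{\delta_1^l},\qquad |\partial_y^l DS(x,y)|\le B\,\frac{\mu}{\delta_2^l}.$$ Then for every real $\lambda\ne0$ and all complex-valued $f\in L^p(\mathbb R)$, $g\in L^q(\mathbb R)$, $h\in L^r(\mathbb R)$, the integral $$\Lambda(f,g,h)=\iint e^{i\lambda S(x,y)}f(x)\,g(y)\,h(x+y)\,\phi(x,y)\,dx\,dy$$ converges absolutely and $$|\Lambda(f,g,h)|\le C\,|\lambda\mu|^{-1/4}\,\|f\|_p\,\|g\|_q\,\|h\|_r.$$ -/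

import Mathlib

noncomputable section

namespace TrilinearOsc

/-- The partial derivative `∂_x F` of a function on the plane. -/
def dx {E : Type*} [NormedAddCommGroup E] [NormedSpace ℝ E] (F : ℝ × ℝ → E) : ℝ × ℝ → E :=
  fun z => fderiv ℝ F z (1, 0)

/-- The partial derivative `∂_y F` of a function on the plane. -/
def dy {E : Type*} [NormedAddCommGroup E] [NormedSpace ℝ E] (F : ℝ × ℝ → E) : ℝ × ℝ → E :=
  fun z => fderiv ℝ F z (0, 1)

/-- The differential operator `D = ∂_x ∂_y (∂_x - ∂_y)`. -/
def D (S : ℝ × ℝ → ℝ) : ℝ × ℝ → ℝ :=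
  dx (dy (fun z => dx S z - dy S z))

/-- `X` is `v`-convex: whenever two points of `X` differ by a real multiple of `v`, the line
segment joining them is contained in `X`. -/
def DirConvex (v : ℝ × ℝ) (X : Set (ℝ × ℝ)) : Prop :=
  ∀ a ∈ X, ∀ b ∈ X, (∃ c : ℝ, a - b = c • v) → segment ℝ a b ⊆ X

/-- `Conv_V(X)`: the smallest set containing `X` that is `v`-convex for all `v ∈ V`. -/
def dirConvexHull (V : Set (ℝ × ℝ)) (X : Set (ℝ × ℝ)) : Set (ℝ × ℝ) :=
  ⋂₀ {Y | X ⊆ Y ∧ ∀ v ∈ V, DirConvex v Y}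

/-- The three directions `u = (1, 0)`, `v = (0, 1)`, `w = (-1, 1)`. -/
def directions : Set (ℝ × ℝ) := {(1, 0), (0, 1), (-1, 1)}

/-- `X` has `x`-width at most `δ₁` and `y`-width at most `δ₂`: any two points on a common
horizontal line are at distance at most `δ₁`, and any two points on a common vertical line are at
distance at most `δ₂`. -/
def HasWidthsLE (X : Set (ℝ × ℝ)) (δ₁ δ₂ : ℝ) : Prop :=
  (∀ x₁ x₂ y : ℝ, (x₁, y) ∈ X → (x₂, y) ∈ X → |x₁ - x₂| ≤ δ₁) ∧
  (∀ x y₁ y₂ : ℝ, (x, y₁) ∈ X → (x, y₂) ∈ X → |y₁ - y₂| ≤ δ₂)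

/-- The integrand `e^{iλS(x,y)} f(x) g(y) h(x+y) φ(x,y)`. -/
def integrand (lam : ℝ) (S : ℝ × ℝ → ℝ) (φ : ℝ × ℝ → ℂ) (f g h : ℝ → ℂ) : ℝ × ℝ → ℂ :=
  fun z => Complex.exp (Complex.I * ((lam * S z : ℝ) : ℂ)) *
    f z.1 * g z.2 * h (z.1 + z.2) * φ z

/-- The trilinear form `Λ(f, g, h)`. -/
def form (lam : ℝ) (S : ℝ × ℝ → ℝ) (φ : ℝ × ℝ → ℂ) (f g h : ℝ → ℂ) : ℂ :=
  ∫ z : ℝ × ℝ, integrand lam S φ f g h z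

/-- The set of exponents `𝒜`: `p, q, r ∈ [2, 4)` with `1/p + 1/q + 1/r = 5/4`. -/
def exponents : Set (ℝ × ℝ × ℝ) :=
  {t | t.1 ∈ Set.Ico (2 : ℝ) 4 ∧ t.2.1 ∈ Set.Ico (2 : ℝ) 4 ∧ t.2.2 ∈ Set.Ico (2 : ℝ) 4 ∧
    1 / t.1 + 1 / t.2.1 + 1 / t.2.2 = 5 / 4}

/-- The norm `‖f‖_p` on the real line with Lebesgue measure (finite for `f ∈ L^p`). -/
def lpNorm (f : ℝ → ℂ) (p : ℝ) : ℝ :=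
  (MeasureTheory.eLpNorm f (ENNReal.ofReal p) MeasureTheory.volume).toReal

/-- `f ∈ L^p(ℝ)`. -/
def InLp (f : ℝ → ℂ) (p : ℝ) : Prop :=
  MeasureTheory.MemLp f (ENNReal.ofReal p) MeasureTheory.volume

end TrilinearOsc

end

/-! ### The diagonal Hardy–Littlewood–Sobolev inequality on the line. -/

namespace TrilinearOsc

open MeasureTheory Set
open scoped ENNReal

/-! Write σ = e^{iλS}φ. The decay is first proved when one exponent is 2, say r = 2. Cauchy–Schwarz
in t = x + y removes h. Expanding the square of the remaining integral over the line x + y = t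
produces a shift τ along (1,-1) and, for each τ, a bilinear form in f(x) conj f(x+τ) and g(y) conj
g(y-τ) with kernel conj σ(x+τ,y-τ) σ(x,y) (`sq_form_le`).

For fixed τ ≠ 0 this form is bounded on L² × L² by T T* and Schur's test
(`BddKernel.bilinear_sq_le`). The T T* kernel is an integral in x whose phase is λ times the second
difference of S over a parallelogram with sides τ(1,-1) and (0,y'-y). By the mean value theorem
(`exists_secondDiff_eq`) the x-derivative of this phase is, up to sign, λτ(y'-y) DS(ξ). The vertices
of the parallelogram lie in the support of φ, so ξ lies in its directional hull, where DS is
controlled; this is why the hull appears. Two integrations by parts (`nonstationary_phase`,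
`mulDiff_integral_le`) give the bound Mδ₁/(1 + (|λ|μ|τ||y'-y|δ₁)²). Its integral in y' is
O(1/(|λ|μ|τ|)), in which δ₁ has cancelled.

The bilinear form is therefore O((|λ|μ|τ|)^{-1/2}) times the two L² norms. For the integral in τ,
|τ|^{-1/2} is split between f and g according to p and q; Cauchy–Schwarz and
Hardy–Littlewood–Sobolev for |f|² and |g|² (`hls_diagonal`) give ‖f‖_p²‖g‖_q² (`trilinear_edge`).
Since all this bounds the square of the form, the final power is -1/4.

Shears permuting f, g, h transfer the estimate to the edges p = 2 and q = 2. Every other exponent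
triple lies on a segment with q fixed joining the edges p = 2 and r = 2, and Riesz–Thorin
(`HasBound.interpolate`, `exists_bound_simpleFunc`) covers it. Simple functions are then replaced by
L^p functions by density. -/

theorem lintegral_abs (g : ℝ → ℝ≥0∞) :
    ∫⁻ u, g |u| = 2 * ∫⁻ u in Ioi 0, g u := by
  have h1 : ∫⁻ u in Ioi (0 : ℝ), g |u| = ∫⁻ u in Ioi 0, g u :=
    setLIntegral_congr_fun measurableSet_Ioi fun u hu => by rw [abs_of_pos hu]
  have h2 : ∫⁻ u in Iio (0 : ℝ), g |u| = ∫⁻ u in Ioi 0, g u := by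
    rw [← h1]
    have := (Measure.measurePreserving_neg (volume : Measure ℝ)).setLIntegral_comp_preimage_emb
      (MeasurableEquiv.neg ℝ).measurableEmbedding (fun u => g |u|) (Ioi 0)
    simpa using this
  rw [← lintegral_add_compl _ (measurableSet_Ioi (a := (0 : ℝ))), compl_Ioi,
    setLIntegral_congr Iio_ae_eq_Iic.symm, h1, h2, two_mul]

theorem lintegral_near {α : ℝ} (h1 : α < 1) {R : ℝ} (hR : 0 < R) (x : ℝ) :
    ∫⁻ y in {y | |x - y| < R}, ENNReal.ofReal (|x - y| ^ (-α)) =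
      ENNReal.ofReal (2 / (1 - α) * R ^ (1 - α)) := by
  have e1 : ∫⁻ y in {y | |x - y| < R}, ENNReal.ofReal (|x - y| ^ (-α)) =
      ∫⁻ u, (Iio R).indicator (fun u => ENNReal.ofReal (u ^ (-α))) |u| := by
    rw [← lintegral_indicator (measurableSet_lt (by fun_prop) (by fun_prop)),
      ← lintegral_sub_left_eq_self _ x]
    simp [indicator]
  have e2 : ∫⁻ u in Ioi (0 : ℝ), (Iio R).indicator (fun u => ENNReal.ofReal (u ^ (-α))) u =
      ENNReal.ofReal (R ^ (1 - α) / (1 - α)) := by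
    have hi : IntervalIntegrable (fun u : ℝ => u ^ (-α)) volume 0 R :=
      intervalIntegral.intervalIntegrable_rpow' (by linarith)
    rw [lintegral_indicator measurableSet_Iio, Measure.restrict_restrict measurableSet_Iio,
      Iio_inter_Ioi, setLIntegral_congr Ioo_ae_eq_Ioc, ← ofReal_integral_eq_lintegral_ofReal,
      ← intervalIntegral.integral_of_le hR.le, integral_rpow (Or.inl (by linarith))]
    · congr 1
      rw [show -α + 1 = 1 - α by ring, Real.zero_rpow (by linarith), sub_zero]
    · exact (intervalIntegrable_iff_integrableOn_Ioc_of_le hR.le).1 hi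
    · filter_upwards [ae_restrict_mem measurableSet_Ioc] with u hu
      exact Real.rpow_nonneg hu.1.le _
  rw [e1, lintegral_abs, e2, show (2 : ℝ≥0∞) = ENNReal.ofReal 2 by simp,
    ← ENNReal.ofReal_mul (by norm_num)]
  congr 1; ring

theorem lintegral_far {R : ℝ} (hR : 0 < R) (x : ℝ) :
    ∫⁻ y in {y | R < |x - y|}, ENNReal.ofReal (|x - y| ^ (-2 : ℝ)) =
      ENNReal.ofReal (2 / R) := by
  have e1 : ∫⁻ y in {y | R < |x - y|}, ENNReal.ofReal (|x - y| ^ (-2 : ℝ)) =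
      ∫⁻ u, (Ioi R).indicator (fun u => ENNReal.ofReal (u ^ (-2 : ℝ))) |u| := by
    rw [← lintegral_indicator (measurableSet_lt (by fun_prop) (by fun_prop)),
      ← lintegral_sub_left_eq_self _ x]
    simp [indicator]
  have e2 : ∫⁻ u in Ioi (0 : ℝ), (Ioi R).indicator (fun u => ENNReal.ofReal (u ^ (-2 : ℝ))) u =
      ENNReal.ofReal (1 / R) := by
    rw [lintegral_indicator measurableSet_Ioi, Measure.restrict_restrict measurableSet_Ioi,
      Ioi_inter_Ioi, sup_eq_left.2 hR.le, ← ofReal_integral_eq_lintegral_ofReal,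
      integral_Ioi_rpow_of_lt (by norm_num) hR]
    · congr 1
      norm_num [Real.rpow_neg_one]
    · exact integrableOn_Ioi_rpow_of_lt (by norm_num) hR
    · filter_upwards [ae_restrict_mem measurableSet_Ioi] with u hu
      exact Real.rpow_nonneg (hR.le.trans (le_of_lt hu)) _
  rw [e1, lintegral_abs, e2, show (2 : ℝ≥0∞) = ENNReal.ofReal 2 by simp,
    ← ENNReal.ofReal_mul (by norm_num)]
  congr 1; ring

/-- Near x the cutoff F ≤ a is used against the locally integrable |x - y|^{-α}. Far from x, Hölder
with exponents s and 2/α is used, which turns the kernel into |x - y|^{-2}. -/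
theorem hls_pointwise {α s : ℝ} (h0 : 0 < α) (h1 : α < 1) (hs : s * (2 - α) = 2) {F : ℝ → ℝ≥0∞}
    (hF : Measurable F) {a i : ℝ} (ha : 0 < a) (hi : 0 < i)
    (hI : ∫⁻ y, F y ^ s = ENNReal.ofReal i) (x : ℝ) :
    ∫⁻ y in {y | F y ≤ ENNReal.ofReal a}, F y * ENNReal.ofReal (|x - y| ^ (-α)) ≤
      ENNReal.ofReal ((2 / (1 - α) + 2 ^ (α / 2)) * (a ^ (s - 1) * i ^ (1 - α))) := by
  have hs' : s = 2 / (2 - α) := (eq_div_iff (by linarith)).2 hs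
  have hs1 : 1 < s := by rw [hs', lt_div_iff₀ (by linarith)]; linarith
  have hinv : 1 / s = 1 - α / 2 := by rw [hs']; field_simp
  have hsα : s * α = 2 * s - 2 := by linarith
  -- At this radius the near bound a R^{1-α} and the far bound i^{1/s} R^{-α/2} both equal a^{s-1}
  -- i^{1-α}.
  set R : ℝ := i / a ^ s with hRdef
  have hR : 0 < R := by positivity
  have near : ∫⁻ y in {y | F y ≤ ENNReal.ofReal a} ∩ {y | |x - y| < R},
      F y * ENNReal.ofReal (|x - y| ^ (-α)) ≤
      ENNReal.ofReal (2 / (1 - α) * (a ^ (s - 1) * i ^ (1 - α))) := by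
    calc _ ≤ ∫⁻ y in {y | F y ≤ ENNReal.ofReal a} ∩ {y | |x - y| < R},
          ENNReal.ofReal a * ENNReal.ofReal (|x - y| ^ (-α)) := by
          refine setLIntegral_mono' ((measurableSet_le hF (by fun_prop)).inter
            (measurableSet_lt (by fun_prop) (by fun_prop))) fun y hy => ?_
          gcongr; exact hy.1
      _ ≤ ∫⁻ y in {y | |x - y| < R},
          ENNReal.ofReal a * ENNReal.ofReal (|x - y| ^ (-α)) :=
          lintegral_mono_set inter_subset_right
      _ = _ := by
          rw [lintegral_const_mul _ (by fun_prop), lintegral_near h1 hR,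
            ← ENNReal.ofReal_mul ha.le]
          congr 1
          rw [hRdef, Real.div_rpow hi.le (by positivity), ← Real.rpow_mul ha.le,
            show s * (1 - α) = 1 - (s - 1) by linarith, Real.rpow_sub ha, Real.rpow_one]
          field_simp
  have far : ∫⁻ y in {y | R < |x - y|},
      F y * ENNReal.ofReal (|x - y| ^ (-α)) ≤
      ENNReal.ofReal (2 ^ (α / 2) * (a ^ (s - 1) * i ^ (1 - α))) := by
    have hpq : s.HolderConjugate (2 / α) := by
      rw [Real.holderConjugate_iff]
      refine ⟨hs1, ?_⟩
      rw [← one_div, hinv]; field_simp; ring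
    refine (ENNReal.lintegral_mul_le_Lp_mul_Lq _ hpq hF.aemeasurable (by fun_prop)).trans ?_
    have e1 : ∫⁻ y in {y | R < |x - y|}, ENNReal.ofReal (|x - y| ^ (-α)) ^ (2 / α) =
        ENNReal.ofReal (2 / R) := by
      rw [← lintegral_far hR x]
      refine setLIntegral_congr_fun (measurableSet_lt (by fun_prop) (by fun_prop)) fun y hy => ?_
      have : 0 < |x - y| := hR.trans hy
      rw [ENNReal.ofReal_rpow_of_pos (by positivity), ← Real.rpow_mul this.le]
      congr 2; field_simp
    rw [e1]
    calc _ ≤ (∫⁻ y, F y ^ s) ^ (1 / s) * ENNReal.ofReal (2 / R) ^ (1 / (2 / α)) := by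
          gcongr; exact Measure.restrict_le_self
      _ = _ := by
          rw [hI, ENNReal.ofReal_rpow_of_pos hi, ENNReal.ofReal_rpow_of_pos (by positivity),
            ← ENNReal.ofReal_mul (by positivity)]
          congr 1
          rw [hinv, one_div_div, hRdef, div_div_eq_mul_div, Real.div_rpow (by positivity) hi.le,
            Real.mul_rpow (by norm_num) (by positivity), ← Real.rpow_mul ha.le,
            show s * (α / 2) = s - 1 by linarith,
            show 1 - α = (1 - α / 2) - α / 2 by ring, Real.rpow_sub hi (1 - α / 2)]
          ring
  have hnull : volume {y : ℝ | |x - y| = R} = 0 := by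
    refine measure_mono_null (t := {x - R, x + R}) (fun y hy => ?_)
      ((Set.finite_insert.2 (Set.finite_singleton _)).measure_zero _)
    rcases (abs_eq hR.le).1 hy with h | h
    · left; linarith
    · right; simp only [mem_singleton_iff]; linarith
  calc _ ≤ ∫⁻ y in ({y | F y ≤ ENNReal.ofReal a} ∩ {y | |x - y| < R}) ∪
        ({y | R < |x - y|} ∪ {y | |x - y| = R}), F y * ENNReal.ofReal (|x - y| ^ (-α)) := by
        refine lintegral_mono_set fun y hy => ?_
        rcases lt_trichotomy |x - y| R with h | h | h
        · exact Or.inl ⟨hy, h⟩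
        · exact Or.inr (Or.inr h)
        · exact Or.inr (Or.inl h)
    _ ≤ _ := by
        refine (lintegral_union_le _ _ _).trans ?_
        rw [add_mul, ENNReal.ofReal_add]
        · refine add_le_add near ((lintegral_union_le _ _ _).trans ?_)
          rw [setLIntegral_measure_zero _ _ hnull, add_zero]
          exact far
        · have : 0 < 1 - α := by linarith
          positivity
        · positivity

/-- The diagonal case of the Hardy–Littlewood–Sobolev inequality on the line. -/
theorem hls_diagonal {α s : ℝ} (h0 : 0 < α) (h1 : α < 1) (hs : s * (2 - α) = 2) :
    ∃ C : ℝ, 0 < C ∧ ∀ F : ℝ → ℝ≥0∞, Measurable F → (∀ x, F x ≠ ∞) →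
      ∫⁻ x, ∫⁻ y, F x * F y * ENNReal.ofReal (|x - y| ^ (-α)) ≤
        ENNReal.ofReal C * (∫⁻ x, F x ^ s) ^ (2 / s) := by
  have hs' : s = 2 / (2 - α) := (eq_div_iff (by linarith)).2 hs
  have hs1 : 1 < s := by rw [hs', lt_div_iff₀ (by linarith)]; linarith
  have hα : 0 < 1 - α := by linarith
  have h2s : 2 / s = 2 - α := by rw [hs']; field_simp
  set C₀ : ℝ := 2 / (1 - α) + 2 ^ (α / 2) with hC₀def
  have hC₀ : 0 < C₀ := by positivity
  refine ⟨2 * C₀, by positivity, fun F hF hFt => ?_⟩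
  rcases eq_or_ne (∫⁻ x, F x ^ s) ∞ with hI | hI
  · rw [hI, ENNReal.top_rpow_of_pos (by positivity), ENNReal.mul_top]
    · exact le_top
    · simpa using hC₀
  rcases eq_or_ne (∫⁻ x, F x ^ s) 0 with hI0 | hI0
  · rw [lintegral_eq_zero_iff (by fun_prop)] at hI0
    refine le_of_eq_of_le (lintegral_eq_zero_of_ae_eq_zero ?_) zero_le
    filter_upwards [hI0] with x hx
    have : F x = 0 := by simpa [ENNReal.rpow_eq_zero_iff, (by linarith : 0 < s), hFt x,
      (by linarith : ¬ s < 0)] using hx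
    simp [this]
  set i := (∫⁻ x, F x ^ s).toReal
  have hi : 0 < i := ENNReal.toReal_pos hI0 hI
  have hIi : ∫⁻ x, F x ^ s = ENNReal.ofReal i := (ENNReal.ofReal_toReal hI).symm
  have hmeas : Measurable (fun z : ℝ × ℝ => F z.1 * F z.2 * ENNReal.ofReal (|z.1 - z.2| ^ (-α))) := by
    fun_prop
  have hms : MeasurableSet {z : ℝ × ℝ | F z.2 ≤ F z.1} :=
    measurableSet_le (by fun_prop) (by fun_prop)
  -- By symmetry it suffices to treat the region where F y ≤ F x. There `hls_pointwise` with a = F x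
  -- bounds the inner integral by F(x)^{s-1} i^{1-α}, and the factor F x completes F(x)^s.
  set g : ℝ × ℝ → ℝ≥0∞ := {z : ℝ × ℝ | F z.2 ≤ F z.1}.indicator
    (fun z => F z.1 * F z.2 * ENNReal.ofReal (|z.1 - z.2| ^ (-α)))
  have hg : Measurable g := hmeas.indicator hms
  have half : ∫⁻ x, ∫⁻ y, g (x, y) ≤ ENNReal.ofReal C₀ * ENNReal.ofReal i ^ (2 / s) := by
    have key : ∀ x, ∫⁻ y, g (x, y) ≤ ENNReal.ofReal (C₀ * i ^ (1 - α)) * F x ^ s := by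
      intro x
      have e : ∫⁻ y, g (x, y) =
          F x * ∫⁻ y in {y | F y ≤ F x}, F y * ENNReal.ofReal (|x - y| ^ (-α)) := by
        rw [← lintegral_const_mul _ (by fun_prop),
          ← lintegral_indicator (measurableSet_le (by fun_prop) (by fun_prop))]
        refine lintegral_congr fun y => ?_
        simp only [g, indicator, mem_ofPred_eq]
        split_ifs <;> ring
      rcases eq_or_ne (F x) 0 with hx | hx
      · rw [e, hx]; simp
      set a := (F x).toReal
      have ha : 0 < a := ENNReal.toReal_pos hx (hFt x)
      have hxa : F x = ENNReal.ofReal a := (ENNReal.ofReal_toReal (hFt x)).symm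
      rw [e, hxa]
      refine (mul_le_mul_right (hls_pointwise h0 h1 hs hF ha hi hIi x) _).trans (le_of_eq ?_)
      rw [ENNReal.ofReal_rpow_of_pos ha, ← ENNReal.ofReal_mul ha.le,
        ← ENNReal.ofReal_mul (by positivity), Real.rpow_sub_one ha.ne']
      congr 1; rw [← hC₀def]; field_simp
    refine (lintegral_mono key).trans (le_of_eq ?_)
    rw [lintegral_const_mul _ (by fun_prop), hIi, ENNReal.ofReal_rpow_of_pos hi,
      ← ENNReal.ofReal_mul (by positivity), ← ENNReal.ofReal_mul (by positivity), h2s,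
      show 2 - α = (1 - α) + 1 by ring, Real.rpow_add_one hi.ne']
    congr 1; ring
  calc ∫⁻ x, ∫⁻ y, F x * F y * ENNReal.ofReal (|x - y| ^ (-α))
      ≤ ∫⁻ x, ∫⁻ y, (g (x, y) + g (y, x)) := by
        refine lintegral_mono fun x => lintegral_mono fun y => ?_
        simp only [g, indicator, mem_ofPred_eq]
        rcases le_total (F y) (F x) with h | h
        · rw [if_pos h]; exact le_self_add
        · rw [if_pos h, abs_sub_comm, mul_comm (F x)]; exact le_add_self
    _ = (∫⁻ x, ∫⁻ y, g (x, y)) + ∫⁻ x, ∫⁻ y, g (y, x) := by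
        rw [← lintegral_add_left (by fun_prop)]
        refine lintegral_congr fun x => lintegral_add_left (by fun_prop) _
    _ = 2 * ∫⁻ x, ∫⁻ y, g (x, y) := by
        rw [lintegral_lintegral_swap (f := fun x y => g (y, x)) (by fun_prop), two_mul]
    _ ≤ 2 * (ENNReal.ofReal C₀ * ENNReal.ofReal i ^ (2 / s)) := by gcongr
    _ = _ := by
        rw [hIi, ENNReal.ofReal_mul (by norm_num), ENNReal.ofReal_ofNat, mul_assoc]

end TrilinearOsc

/-! ### Bounded kernels, T T* and Schur's test. -/

namespace TrilinearOsc

open MeasureTheory Set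
open scoped ENNReal ComplexConjugate

/-- Bounded measurable functions vanishing off a bounded set. -/
def BddKernel {X : Type*} [NormedAddCommGroup X] [MeasurableSpace X] (k : X → ℂ) : Prop :=
  Measurable k ∧ (∃ C, ∀ z, ‖k z‖ ≤ C) ∧ ∃ R, ∀ z, R < ‖z‖ → k z = 0

theorem BddKernel.integrable {X : Type*} [NormedAddCommGroup X] [ProperSpace X] [MeasurableSpace X]
    [BorelSpace X] {μ : Measure X} [IsFiniteMeasureOnCompacts μ] {k : X → ℂ} (hk : BddKernel k) :
    Integrable k μ := by
  obtain ⟨hm, ⟨C, hC⟩, R, hR⟩ := hk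
  rw [← integrableOn_iff_integrable_of_support_subset (s := Metric.closedBall 0 R)]
  · exact Measure.integrableOn_of_bounded (isCompact_closedBall 0 R).measure_lt_top.ne
      hm.aestronglyMeasurable (Filter.Eventually.of_forall hC)
  · intro z hz
    by_contra h
    exact hz (hR z (by simpa using h))

theorem BddKernel.mul_bdd {X : Type*} [NormedAddCommGroup X] [MeasurableSpace X]
    {k F : X → ℂ} (hk : BddKernel k) (hF : Measurable F) (hb : ∃ C, ∀ z, ‖F z‖ ≤ C) :
    BddKernel (fun z => F z * k z) := by
  obtain ⟨hm, ⟨C, hC⟩, R, hR⟩ := hk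
  obtain ⟨C', hC'⟩ := hb
  refine ⟨hF.mul hm, ⟨C' * C, fun z => ?_⟩, R, fun z hz => by simp only [hR z hz, mul_zero]⟩
  rw [norm_mul]
  exact mul_le_mul (hC' z) (hC z) (norm_nonneg _) ((norm_nonneg _).trans (hC' z))

theorem BddKernel.comp {X Y : Type*} [NormedAddCommGroup X] [MeasurableSpace X]
    [NormedAddCommGroup Y] [MeasurableSpace Y]
    {k : X → ℂ} (hk : BddKernel k) {e : Y → X} (he : Measurable e) {K : ℝ} (hK : 0 < K)
    (hn : ∀ y, ‖y‖ ≤ K * ‖e y‖) : BddKernel (k ∘ e) := by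
  obtain ⟨hm, ⟨C, hC⟩, R, hR⟩ := hk
  refine ⟨hm.comp he, ⟨C, fun z => hC _⟩, K * R, fun z hz => hR _ ?_⟩
  exact lt_of_mul_lt_mul_left (hz.trans_le (hn z)) hK.le

theorem BddKernel.conj_mul_fiber {k : ℝ × ℝ → ℂ} (hk : BddKernel k) :
    BddKernel (fun w : ℝ × ℝ × ℝ => k (w.1, w.2.1) * conj (k (w.1, w.2.2))) := by
  obtain ⟨hm, ⟨C, hC⟩, R, hR⟩ := hk
  refine ⟨by fun_prop, ⟨C * C, fun w => ?_⟩, R, fun w hw => ?_⟩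
  · rw [norm_mul, RCLike.norm_conj]
    exact mul_le_mul (hC _) (hC _) (norm_nonneg _) ((norm_nonneg _).trans (hC 0))
  · simp only [Prod.norm_def, lt_sup_iff] at hw
    rcases hw with hw | hw | hw
    · simp only [hR (w.1, w.2.1) (hw.trans_le (le_max_left _ _)), zero_mul]
    · simp only [hR (w.1, w.2.1) (hw.trans_le (le_max_right _ _)), zero_mul]
    · simp only [hR (w.1, w.2.2) (hw.trans_le (le_max_right _ _)), map_zero, mul_zero]

theorem BddKernel.lintegral_sq {k : ℝ × ℝ → ℂ} (hk : BddKernel k) :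
    ∫⁻ x, ‖∫ y, k (x, y)‖ₑ ^ 2 = ‖∫ w : ℝ × ℝ × ℝ, k (w.1, w.2.1) * conj (k (w.1, w.2.2))‖ₑ := by
  have hW : Integrable (fun w : ℝ × ℝ × ℝ => k (w.1, w.2.1) * conj (k (w.1, w.2.2))) volume :=
    hk.conj_mul_fiber.integrable
  have e : ∀ x, ∫ v : ℝ × ℝ, k (x, v.1) * conj (k (x, v.2)) = ((‖∫ y, k (x, y)‖ ^ 2 : ℝ) : ℂ) := by
    intro x
    have := integral_prod_mul (μ := (volume : Measure ℝ)) (ν := (volume : Measure ℝ))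
      (fun y => k (x, y)) (fun y => conj (k (x, y)))
    rw [← Measure.volume_eq_prod] at this
    rw [this, integral_conj, RCLike.mul_conj]
    norm_cast
  have e2 : ∫ w : ℝ × ℝ × ℝ, k (w.1, w.2.1) * conj (k (w.1, w.2.2)) =
      ((∫ x, ‖∫ y, k (x, y)‖ ^ 2 : ℝ) : ℂ) := by
    rw [Measure.volume_eq_prod, integral_prod _ hW, ← integral_complex_ofReal]
    exact integral_congr_ae (Filter.Eventually.of_forall e)
  have hi : Integrable (fun x => ‖∫ y, k (x, y)‖ ^ 2) := by
    have h := hW.integral_prod_left.norm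
    refine h.congr (Filter.Eventually.of_forall fun x => ?_)
    simp only
    rw [e x]
    simp
  rw [e2, ← ofReal_norm, Complex.norm_real, Real.norm_eq_abs, abs_of_nonneg (integral_nonneg fun _ => by positivity),
    ofReal_integral_eq_lintegral_ofReal hi (Filter.Eventually.of_forall fun _ => by positivity)]
  refine lintegral_congr fun x => ?_
  rw [ENNReal.ofReal_pow (norm_nonneg _), ofReal_norm]

/-- After the square is expanded, x is integrated first and absolute values are taken only in (y,
y'), so the oscillation in x is kept. -/
theorem BddKernel.lintegral_sq_le {k : ℝ × ℝ → ℂ} (hk : BddKernel k) :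
    ∫⁻ x, ‖∫ y, k (x, y)‖ₑ ^ 2 ≤ ∫⁻ y, ∫⁻ y', ‖∫ x, k (x, y) * conj (k (x, y'))‖ₑ := by
  have hm := hk.1
  rw [hk.lintegral_sq, Measure.volume_eq_prod, integral_prod_symm _ hk.conj_mul_fiber.integrable]
  refine (enorm_integral_le_lintegral_enorm _).trans (le_of_eq ?_)
  refine lintegral_prod _ (Measurable.aemeasurable ?_)
  refine Measurable.enorm (StronglyMeasurable.measurable ?_)
  refine StronglyMeasurable.integral_prod_left
    (f := fun x (v : ℝ × ℝ) => k (x, v.1) * conj (k (x, v.2))) ?_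
  refine Measurable.stronglyMeasurable ?_
  simp only [Function.uncurry_def]
  fun_prop

/-- The same expansion with y' = y + τ, but with absolute values only in τ: for each shift the
cancellation in both remaining variables is kept. -/
theorem BddKernel.lintegral_sq_le_shift {k : ℝ × ℝ → ℂ} (hk : BddKernel k) :
    ∫⁻ t, ‖∫ x, k (t, x)‖ₑ ^ 2 ≤
      ∫⁻ τ, ‖∫ z : ℝ × ℝ, k z * conj (k (z.1, z.2 + τ))‖ₑ := by
  have hm := hk.1
  let e : ℝ × ℝ × ℝ ≃ᵐ ℝ × ℝ × ℝ :=
    MeasurableEquiv.prodCongr (MeasurableEquiv.refl ℝ) (MeasurableEquiv.shearAddRight ℝ)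
  have he : MeasurePreserving e volume volume :=
    (MeasurePreserving.id (volume : Measure ℝ)).prod
      (measurePreserving_prod_add (volume : Measure ℝ) volume)
  have ha : MeasurePreserving (MeasurableEquiv.prodAssoc : (ℝ × ℝ) × ℝ ≃ᵐ _) volume volume :=
    measurePreserving_prodAssoc (volume : Measure ℝ) volume volume
  have hi : Integrable (fun w : (ℝ × ℝ) × ℝ => k w.1 * conj (k (w.1.1, w.1.2 + w.2))) volume :=
    ((he.comp ha).integrable_comp_emb
      (e.measurableEmbedding.comp MeasurableEquiv.prodAssoc.measurableEmbedding)).2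
      (hk.conj_mul_fiber.integrable (μ := volume))
  rw [hk.lintegral_sq, ← he.integral_comp', ← ha.integral_comp']
  have : ∫ w : (ℝ × ℝ) × ℝ, k w.1 * conj (k (w.1.1, w.1.2 + w.2)) =
      ∫ τ, ∫ z : ℝ × ℝ, k z * conj (k (z.1, z.2 + τ)) := by
    rw [Measure.volume_eq_prod (ℝ × ℝ) ℝ, integral_prod_symm _ hi]
  exact (congrArg enorm this).trans_le (enorm_integral_le_lintegral_enorm _)

theorem lintegral_mul_sq_le {X : Type*} [MeasurableSpace X] {μ : Measure X} {f g : X → ℝ≥0∞}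
    (hf : AEMeasurable f μ) (hg : AEMeasurable g μ) :
    (∫⁻ x, f x * g x ∂μ) ^ 2 ≤ (∫⁻ x, f x ^ 2 ∂μ) * ∫⁻ x, g x ^ 2 ∂μ := by
  have h := ENNReal.lintegral_mul_norm_pow_le (hf.pow_const (2 : ℝ)) (hg.pow_const (2 : ℝ))
    (p := 1 / 2) (q := 1 / 2) (by norm_num) (by norm_num) (by norm_num)
  simp only [← ENNReal.rpow_mul] at h
  norm_num at h
  calc _ ≤ _ := pow_le_pow_left' h 2
    _ = _ := by
      rw [mul_pow, ← ENNReal.rpow_natCast, ← ENNReal.rpow_mul, ← ENNReal.rpow_natCast,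
        ← ENNReal.rpow_mul]
      norm_num

theorem ennreal_mul_le_sq_add_sq (a b : ℝ≥0∞) : a * b ≤ a ^ 2 + b ^ 2 := by
  rcases le_total a b with h | h
  · exact (mul_le_mul_left h b).trans (by rw [sq b]; exact le_add_self)
  · exact (mul_le_mul_right h a).trans (by rw [sq a]; exact le_self_add)

/-- Schur's test applied to `T T*`. -/
theorem BddKernel.bilinear_sq_le {k : ℝ × ℝ → ℂ} (hk : BddKernel k) {F G : ℝ → ℂ}
    (hF : Measurable F) (hFb : ∃ C, ∀ x, ‖F x‖ ≤ C) (hG : Measurable G) (hGb : ∃ C, ∀ x, ‖G x‖ ≤ C)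
    {Q : ℝ≥0∞} (hQ : ∀ y, ∫⁻ y', ‖∫ x, k (x, y) * conj (k (x, y'))‖ₑ ≤ Q) :
    ‖∫ z : ℝ × ℝ, F z.1 * (G z.2 * k z)‖ₑ ^ 2 ≤
      2 * Q * (∫⁻ x, ‖F x‖ₑ ^ 2) * ∫⁻ y, ‖G y‖ₑ ^ 2 := by
  have hGk : BddKernel (fun z : ℝ × ℝ => G z.2 * k z) :=
    hk.mul_bdd (F := fun z => G z.2) (by fun_prop) (hGb.imp fun C h z => h z.2)
  have hFGk : BddKernel (fun z : ℝ × ℝ => F z.1 * (G z.2 * k z)) :=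
    hGk.mul_bdd (F := fun z => F z.1) (by fun_prop) (hFb.imp fun C h z => h z.1)
  have hm := hk.1
  have hT : Measurable fun x => ∫ y, G y * k (x, y) := by
    refine StronglyMeasurable.measurable (StronglyMeasurable.integral_prod_right
      (f := fun x y => G y * k (x, y)) (Measurable.stronglyMeasurable ?_))
    simp only [Function.uncurry_def]
    fun_prop
  have hKm : Measurable fun v : ℝ × ℝ => ‖∫ x, k (x, v.1) * conj (k (x, v.2))‖ₑ := by
    refine Measurable.enorm (StronglyMeasurable.measurable (StronglyMeasurable.integral_prod_left
      (f := fun x (v : ℝ × ℝ) => k (x, v.1) * conj (k (x, v.2)))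
        (Measurable.stronglyMeasurable ?_)))
    simp only [Function.uncurry_def]
    fun_prop
  have hKy : ∀ y, Measurable fun y' => ‖∫ x, k (x, y) * conj (k (x, y'))‖ₑ :=
    fun y => hKm.comp measurable_prodMk_left
  have hsymm : ∀ y y', ‖∫ x, k (x, y) * conj (k (x, y'))‖ₑ = ‖∫ x, k (x, y') * conj (k (x, y))‖ₑ := by
    intro y y'
    rw [← RCLike.enorm_conj, ← integral_conj]
    simp only [map_mul, RCLike.conj_conj, mul_comm]
  have step1 : ‖∫ z : ℝ × ℝ, F z.1 * (G z.2 * k z)‖ₑ ≤ ∫⁻ x, ‖F x‖ₑ * ‖∫ y, G y * k (x, y)‖ₑ := by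
    rw [Measure.volume_eq_prod, integral_prod _ hFGk.integrable]
    simp only [integral_const_mul]
    exact (enorm_integral_le_lintegral_enorm _).trans (le_of_eq (by simp only [enorm_mul]))
  have step2 : ∫⁻ x, ‖∫ y, G y * k (x, y)‖ₑ ^ 2 ≤ 2 * Q * ∫⁻ y, ‖G y‖ₑ ^ 2 := by
    refine hGk.lintegral_sq_le.trans ?_
    have e : ∀ y y', ‖∫ x, G y * k (x, y) * conj (G y' * k (x, y'))‖ₑ =
        ‖G y‖ₑ * ‖G y'‖ₑ * ‖∫ x, k (x, y) * conj (k (x, y'))‖ₑ := by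
      intro y y'
      rw [← RCLike.enorm_conj (G y'), ← enorm_mul, ← enorm_mul, ← integral_const_mul]
      congr 2; ext x; simp only [map_mul]; ring
    simp only [e]
    have hA : ∫⁻ y, ∫⁻ y', ‖G y‖ₑ ^ 2 * ‖∫ x, k (x, y) * conj (k (x, y'))‖ₑ ≤
        Q * ∫⁻ y, ‖G y‖ₑ ^ 2 := by
      rw [← lintegral_const_mul _ (by fun_prop)]
      refine lintegral_mono fun y => ?_
      rw [lintegral_const_mul _ (hKy y), mul_comm Q]
      gcongr
      exact hQ y
    -- The product of the two values of G is at most the sum of their squares. As the T T* kernel is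
    -- Hermitian, both terms have the same integral, which is the source of the factor 2 in front of
    -- `Q`.
    calc _ ≤ ∫⁻ y, ∫⁻ y', (‖G y‖ₑ ^ 2 * ‖∫ x, k (x, y) * conj (k (x, y'))‖ₑ +
          ‖G y'‖ₑ ^ 2 * ‖∫ x, k (x, y') * conj (k (x, y))‖ₑ) := by
          refine lintegral_mono fun y => lintegral_mono fun y' => ?_
          rw [hsymm y' y, ← add_mul]
          gcongr
          exact ennreal_mul_le_sq_add_sq _ _
      _ = (∫⁻ y, ∫⁻ y', ‖G y‖ₑ ^ 2 * ‖∫ x, k (x, y) * conj (k (x, y'))‖ₑ) +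
          ∫⁻ y, ∫⁻ y', ‖G y'‖ₑ ^ 2 * ‖∫ x, k (x, y') * conj (k (x, y))‖ₑ := by
          rw [← lintegral_add_left (by fun_prop)]
          exact lintegral_congr fun y => lintegral_add_left ((hKy y).const_mul _) _
      _ = 2 * ∫⁻ y, ∫⁻ y', ‖G y‖ₑ ^ 2 * ‖∫ x, k (x, y) * conj (k (x, y'))‖ₑ := by
          rw [lintegral_lintegral_swap
            (f := fun y y' => ‖G y'‖ₑ ^ 2 * ‖∫ x, k (x, y') * conj (k (x, y))‖ₑ), two_mul]
          exact Measurable.aemeasurable (by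
            simp only [Function.uncurry_def]
            exact (by fun_prop : Measurable fun v : ℝ × ℝ => ‖G v.2‖ₑ ^ 2).mul
              (hKm.comp measurable_swap))
      _ ≤ _ := by rw [mul_assoc]; gcongr
  calc _ ≤ (∫⁻ x, ‖F x‖ₑ * ‖∫ y, G y * k (x, y)‖ₑ) ^ 2 := pow_le_pow_left' step1 2
    _ ≤ (∫⁻ x, ‖F x‖ₑ ^ 2) * ∫⁻ x, ‖∫ y, G y * k (x, y)‖ₑ ^ 2 :=
        lintegral_mul_sq_le (by fun_prop) hT.enorm.aemeasurable
    _ ≤ (∫⁻ x, ‖F x‖ₑ ^ 2) * (2 * Q * ∫⁻ y, ‖G y‖ₑ ^ 2) := by gcongr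
    _ = _ := by ring

end TrilinearOsc

/-! ### The trilinear estimate with h in L². -/

namespace TrilinearOsc

open MeasureTheory Set
open scoped ENNReal ComplexConjugate

/-- Substitute y = x + τ in `hls_diagonal`. In this form the inequality applies to the
autocorrelations of |f|² and |g|². -/
theorem hls_shift {α s : ℝ} (h0 : 0 < α) (h1 : α < 1) (hs : s * (2 - α) = 2) :
    ∃ C : ℝ, 0 < C ∧ ∀ F : ℝ → ℝ≥0∞, Measurable F → (∀ x, F x ≠ ∞) →
      ∫⁻ τ, ENNReal.ofReal (|τ| ^ (-α)) * ∫⁻ x, F x * F (x + τ) ≤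
        ENNReal.ofReal C * (∫⁻ x, F x ^ s) ^ (2 / s) := by
  obtain ⟨C, hC, h⟩ := hls_diagonal h0 h1 hs
  refine ⟨C, hC, fun F hF hFt => (le_of_eq ?_).trans (h F hF hFt)⟩
  calc _ = ∫⁻ τ, ∫⁻ x, ENNReal.ofReal (|τ| ^ (-α)) * (F x * F (x + τ)) := by
        refine lintegral_congr fun τ => (lintegral_const_mul _ (by fun_prop)).symm
    _ = ∫⁻ x, ∫⁻ τ, ENNReal.ofReal (|τ| ^ (-α)) * (F x * F (x + τ)) :=
        lintegral_lintegral_swap (by fun_prop)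
    _ = _ := by
        refine lintegral_congr fun x => ?_
        rw [← lintegral_add_left_eq_self
          (fun y => F x * F y * ENNReal.ofReal (|x - y| ^ (-α))) x]
        refine lintegral_congr fun y => ?_
        rw [show x - (x + y) = -y by ring, abs_neg, mul_comm]

/-- The shear `(x, y) ↦ (x + y, x)`. -/
def sumFst : ℝ × ℝ ≃ᵐ ℝ × ℝ where
  toFun z := (z.1 + z.2, z.1)
  invFun w := (w.2, w.1 - w.2)
  left_inv z := by simp
  right_inv w := by simp
  measurable_toFun := by dsimp; fun_prop
  measurable_invFun := by dsimp; fun_prop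

theorem measurePreserving_sumFst : MeasurePreserving sumFst volume volume := by
  have h := (measurePreserving_add_prod (volume : Measure ℝ) volume).comp
    (Measure.measurePreserving_swap (μ := (volume : Measure ℝ)) (ν := (volume : Measure ℝ)))
  have e : ⇑sumFst = (fun z : ℝ × ℝ => (z.1 + z.2, z.2)) ∘ Prod.swap := by
    ext z
    · exact add_comm _ _
    · rfl
  rw [e]
  exact h

theorem eLpNorm_pow_four {p : ℝ} (hp : 0 < p) (f : ℝ → ℂ) :
    (∫⁻ x, (‖f x‖ₑ ^ 2) ^ (p / 2)) ^ (2 / (p / 2)) = eLpNorm f (ENNReal.ofReal p) volume ^ 4 := by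
  rw [eLpNorm_eq_lintegral_rpow_enorm_toReal (by simpa using hp) ENNReal.ofReal_ne_top,
    ENNReal.toReal_ofReal hp.le, ← ENNReal.rpow_natCast, ← ENNReal.rpow_mul]
  congr 1
  · refine lintegral_congr fun x => ?_
    rw [← ENNReal.rpow_natCast, ← ENNReal.rpow_mul]
    congr 1; push_cast; ring
  · push_cast; ring

theorem eLpNorm_two_sq (f : ℝ → ℂ) :
    ∫⁻ x, ‖f x‖ₑ ^ 2 = eLpNorm f 2 volume ^ 2 := by
  rw [eLpNorm_eq_lintegral_rpow_enorm_toReal two_ne_zero ENNReal.ofNat_ne_top,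
    ← ENNReal.rpow_natCast, ← ENNReal.rpow_mul]
  norm_num

/-- The kernel of the bilinear form obtained from `σ` by the difference `τ` along `(1, -1)`. -/
def diffKernel (σ : ℝ × ℝ → ℂ) (τ : ℝ) : ℝ × ℝ → ℂ :=
  fun z => conj (σ (z.1 + τ, z.2 - τ)) * σ z

theorem BddKernel.diffKernel {σ : ℝ × ℝ → ℂ} (hσ : BddKernel σ) (τ : ℝ) :
    BddKernel (diffKernel σ τ) := by
  have hm := hσ.1
  exact hσ.mul_bdd (by fun_prop) (hσ.2.1.imp fun C hC z => by simpa using hC _)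

theorem bdd_mul_conj_shift {f : ℝ → ℂ} (hb : ∃ C, ∀ x, ‖f x‖ ≤ C) (e : ℝ → ℝ) :
    ∃ C, ∀ x, ‖f x * conj (f (e x))‖ ≤ C := by
  obtain ⟨C, hC⟩ := hb
  refine ⟨C * C, fun x => ?_⟩
  rw [norm_mul, RCLike.norm_conj]
  exact mul_le_mul (hC _) (hC _) (norm_nonneg _) ((norm_nonneg _).trans (hC 0))

/-- In the coordinates (t, x) with t = x + y, h depends on t alone, so Cauchy–Schwarz in t splits it
off. Shifting x by τ at fixed t moves y by -τ. -/
theorem sq_form_le {σ : ℝ × ℝ → ℂ} (hσ : BddKernel σ) {f g h : ℝ → ℂ}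
    (hf : Measurable f) (hfb : ∃ C, ∀ x, ‖f x‖ ≤ C) (hg : Measurable g) (hgb : ∃ C, ∀ x, ‖g x‖ ≤ C)
    (hh : Measurable h) (hhb : ∃ C, ∀ x, ‖h x‖ ≤ C) :
    ‖∫ z : ℝ × ℝ, σ z * (f z.1 * g z.2 * h (z.1 + z.2))‖ₑ ^ 2 ≤
      (∫⁻ t, ‖h t‖ₑ ^ 2) * ∫⁻ τ, ‖∫ z : ℝ × ℝ, (f z.1 * conj (f (z.1 + τ))) *
        ((g z.2 * conj (g (z.2 - τ))) * diffKernel σ τ z)‖ₑ := by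
  have hk0 : BddKernel (fun z : ℝ × ℝ => g z.2 * (f z.1 * σ z)) :=
    (hσ.mul_bdd (F := fun z => f z.1) (by fun_prop) (hfb.imp fun C h z => h z.1)).mul_bdd
      (F := fun z => g z.2) (by fun_prop) (hgb.imp fun C h z => h z.2)
  set k : ℝ × ℝ → ℂ := (fun z : ℝ × ℝ => g z.2 * (f z.1 * σ z)) ∘ sumFst.symm with hkdef
  have hk : BddKernel k := by
    refine hk0.comp sumFst.symm.measurable (K := 2) (by norm_num) fun w => ?_
    have e : sumFst.symm w = (w.2, w.1 - w.2) := rfl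
    rw [e]
    simp only [Prod.norm_def, Real.norm_eq_abs]
    have h1 := le_max_left |w.2| |w.1 - w.2|
    have h2 := le_max_right |w.2| |w.1 - w.2|
    refine max_le ?_ (by linarith [abs_nonneg w.2])
    have := abs_add_le w.2 (w.1 - w.2)
    rw [add_sub_cancel] at this
    linarith
  have hhk : BddKernel (fun w : ℝ × ℝ => h w.1 * k w) :=
    hk.mul_bdd (F := fun w => h w.1) (by fun_prop) (hhb.imp fun C h z => h z.1)
  have hm := hk.1
  have hT : Measurable fun t => ∫ x, k (t, x) := by
    refine StronglyMeasurable.measurable (StronglyMeasurable.integral_prod_right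
      (f := fun x y => k (x, y)) (Measurable.stronglyMeasurable ?_))
    simp only [Function.uncurry_def]
    fun_prop
  have e1 : ∫ z : ℝ × ℝ, σ z * (f z.1 * g z.2 * h (z.1 + z.2)) = ∫ t, h t * ∫ x, k (t, x) := by
    simp only [← integral_const_mul]
    rw [← integral_prod _ hhk.integrable, ← Measure.volume_eq_prod,
      ← measurePreserving_sumFst.integral_comp' (fun w => h w.1 * k w)]
    refine integral_congr_ae (Filter.Eventually.of_forall fun z => ?_)
    simp only [hkdef, Function.comp_apply, MeasurableEquiv.symm_apply_apply]
    rw [show (sumFst z).1 = z.1 + z.2 from rfl]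
    ring
  have e2 : ∀ τ, ∫ w : ℝ × ℝ, k w * conj (k (w.1, w.2 + τ)) =
      ∫ z : ℝ × ℝ, (f z.1 * conj (f (z.1 + τ))) *
        ((g z.2 * conj (g (z.2 - τ))) * diffKernel σ τ z) := by
    intro τ
    rw [← measurePreserving_sumFst.integral_comp']
    refine integral_congr_ae (Filter.Eventually.of_forall fun z => ?_)
    simp only [hkdef, Function.comp_apply, MeasurableEquiv.symm_apply_apply, diffKernel]
    have : sumFst.symm ((sumFst z).1, (sumFst z).2 + τ) = (z.1 + τ, z.2 - τ) := by
      ext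
      · rfl
      · change (z.1 + z.2) - (z.1 + τ) = z.2 - τ
        ring
    rw [this]
    simp only [map_mul]
    ring
  rw [e1]
  calc _ ≤ (∫⁻ t, ‖h t‖ₑ * ‖∫ x, k (t, x)‖ₑ) ^ 2 := by
        refine pow_le_pow_left' ((enorm_integral_le_lintegral_enorm _).trans (le_of_eq ?_)) 2
        simp only [enorm_mul]
    _ ≤ (∫⁻ t, ‖h t‖ₑ ^ 2) * ∫⁻ t, ‖∫ x, k (t, x)‖ₑ ^ 2 :=
        lintegral_mul_sq_le (by fun_prop) hT.enorm.aemeasurable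
    _ ≤ _ := by
        refine mul_le_mul_right (hk.lintegral_sq_le_shift.trans (le_of_eq ?_)) _
        simp only [e2]

/-- Schur's test bounds the form at shift τ by |τ|^{-1/2} times L² norms. With α + β = 1 this weight
is the square root of |τ|^{-α}|τ|^{-β}, so Cauchy–Schwarz in τ leaves one Hardy–Littlewood–Sobolev
integral for f and one for g. -/
theorem trilinear_edge {p q : ℝ} (hp : 2 < p) (hq : 2 < q) 
    (hpq : 1 / p + 1 / q = 3 / 4) :
    ∃ C : ℝ, 0 < C ∧ ∀ (σ : ℝ × ℝ → ℂ), BddKernel σ → ∀ Q : ℝ, 0 < Q →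
      (∀ τ ≠ 0, ∀ y, ∫⁻ y', ‖∫ x, diffKernel σ τ (x, y) * conj (diffKernel σ τ (x, y'))‖ₑ ≤
        ENNReal.ofReal (Q / |τ|)) →
      ∀ f g h : ℝ → ℂ, Measurable f → (∃ C, ∀ x, ‖f x‖ ≤ C) → Measurable g →
        (∃ C, ∀ x, ‖g x‖ ≤ C) → Measurable h → (∃ C, ∀ x, ‖h x‖ ≤ C) →
        ‖∫ z : ℝ × ℝ, σ z * (f z.1 * g z.2 * h (z.1 + z.2))‖ₑ ≤
          ENNReal.ofReal (C * Q ^ (1 / 4 : ℝ)) * eLpNorm f (ENNReal.ofReal p) volume *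
            eLpNorm g (ENNReal.ofReal q) volume * eLpNorm h 2 volume := by
  have hp0 : 0 < p := by linarith
  have hq0 : 0 < q := by linarith
  -- The power for which the inequality holds at s = p/2, the exponent of |f|²; `β` plays the same
  -- role for g. Both lie in (0, 1) since p, q > 2 and α + β = 1.
  set α : ℝ := 2 - 4 / p with hα
  set β : ℝ := 2 - 4 / q with hβ
  have hαβ : α + β = 1 := by rw [hα, hβ]; linarith [div_eq_mul_one_div 4 p, div_eq_mul_one_div 4 q]
  have hα0 : 0 < α := by rw [hα, sub_pos, div_lt_iff₀ hp0]; linarith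
  have hβ0 : 0 < β := by rw [hβ, sub_pos, div_lt_iff₀ hq0]; linarith
  obtain ⟨C₁, hC₁, H₁⟩ := hls_shift (α := α) (s := p / 2) hα0 (by linarith)
    (by rw [hα]; field_simp; ring)
  obtain ⟨C₂, hC₂, H₂⟩ := hls_shift (α := β) (s := q / 2) hβ0 (by linarith)
    (by rw [hβ]; field_simp; ring)
  refine ⟨(2 * C₁ * C₂) ^ (1 / 4 : ℝ), by positivity,
    fun σ hσ Q hQ hK f g h hf hfb hg hgb hh hhb => ?_⟩
  set a : ℝ → ℝ≥0∞ := fun τ => ∫⁻ x, ‖f x‖ₑ ^ 2 * ‖f (x + τ)‖ₑ ^ 2 with ha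
  set b : ℝ → ℝ≥0∞ := fun τ => ∫⁻ y, ‖g y‖ₑ ^ 2 * ‖g (y - τ)‖ₑ ^ 2 with hb
  have ham : Measurable a := Measurable.lintegral_prod_right' (f := fun w : ℝ × ℝ =>
    ‖f w.2‖ₑ ^ 2 * ‖f (w.2 + w.1)‖ₑ ^ 2) (by fun_prop)
  have hbm : Measurable b := Measurable.lintegral_prod_right' (f := fun w : ℝ × ℝ =>
    ‖g w.2‖ₑ ^ 2 * ‖g (w.2 - w.1)‖ₑ ^ 2) (by fun_prop)
  have hA : ∫⁻ τ, ENNReal.ofReal (|τ| ^ (-α)) * a τ ≤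
      ENNReal.ofReal C₁ * eLpNorm f (ENNReal.ofReal p) volume ^ 4 := by
    rw [← eLpNorm_pow_four hp0]
    exact H₁ (fun x => ‖f x‖ₑ ^ 2) (by fun_prop) fun x => by simp
  have hB : ∫⁻ τ, ENNReal.ofReal (|τ| ^ (-β)) * b τ ≤
      ENNReal.ofReal C₂ * eLpNorm g (ENNReal.ofReal q) volume ^ 4 := by
    rw [← eLpNorm_pow_four hq0]
    refine le_trans (le_of_eq ?_) (H₂ (fun x => ‖g x‖ₑ ^ 2) (by fun_prop) fun x => by simp)
    rw [← lintegral_neg_eq_self]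
    simp only [abs_neg, hb, sub_neg_eq_add]
  have hτ : ∀ τ ≠ 0, ‖∫ z : ℝ × ℝ, (f z.1 * conj (f (z.1 + τ))) *
        ((g z.2 * conj (g (z.2 - τ))) * diffKernel σ τ z)‖ₑ ≤
      ENNReal.ofReal (2 * Q) ^ (1 / 2 : ℝ) * ((ENNReal.ofReal (|τ| ^ (-α)) * a τ) ^ (1 / 2 : ℝ) *
        (ENNReal.ofReal (|τ| ^ (-β)) * b τ) ^ (1 / 2 : ℝ)) := by
    intro τ hτ
    have hτ' : 0 < |τ| := abs_pos.2 hτ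
    have := (hσ.diffKernel τ).bilinear_sq_le (F := fun x => f x * conj (f (x + τ)))
      (G := fun y => g y * conj (g (y - τ))) (by fun_prop)
      (bdd_mul_conj_shift hfb _) (by fun_prop) (bdd_mul_conj_shift hgb _) (hK τ hτ)
    rw [← ENNReal.pow_le_pow_left_iff two_ne_zero]
    refine this.trans (le_of_eq ?_)
    rw [← ENNReal.mul_rpow_of_nonneg _ _ (by norm_num),
      ← ENNReal.mul_rpow_of_nonneg _ _ (by norm_num), ← ENNReal.rpow_natCast, ← ENNReal.rpow_mul]
    norm_num only [ENNReal.rpow_one]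
    simp only [enorm_mul, RCLike.enorm_conj, mul_pow]
    rw [show 2 * ENNReal.ofReal (Q / |τ|) = ENNReal.ofReal (2 * Q) *
      (ENNReal.ofReal (|τ| ^ (-α)) * ENNReal.ofReal (|τ| ^ (-β))) by
        rw [← ENNReal.ofReal_mul (by positivity), ← ENNReal.ofReal_mul (by positivity),
          ← Real.rpow_add hτ', show -α + -β = -1 by linarith, Real.rpow_neg_one,
          show (2 : ℝ≥0∞) = ENNReal.ofReal 2 by simp, ← ENNReal.ofReal_mul (by positivity)]
        congr 1; field_simp]
    ring
  have hsum : ∫⁻ τ, ‖∫ z : ℝ × ℝ, (f z.1 * conj (f (z.1 + τ))) *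
        ((g z.2 * conj (g (z.2 - τ))) * diffKernel σ τ z)‖ₑ ≤
      ENNReal.ofReal (2 * Q) ^ (1 / 2 : ℝ) *
        ((ENNReal.ofReal C₁ * eLpNorm f (ENNReal.ofReal p) volume ^ 4) ^ (1 / 2 : ℝ) *
        (ENNReal.ofReal C₂ * eLpNorm g (ENNReal.ofReal q) volume ^ 4) ^ (1 / 2 : ℝ)) := by
    refine (lintegral_mono_ae (g := fun τ => ENNReal.ofReal (2 * Q) ^ (1 / 2 : ℝ) *
      ((ENNReal.ofReal (|τ| ^ (-α)) * a τ) ^ (1 / 2 : ℝ) *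
        (ENNReal.ofReal (|τ| ^ (-β)) * b τ) ^ (1 / 2 : ℝ))) ?_).trans ?_
    · filter_upwards [compl_mem_ae_iff.2 (measure_singleton (μ := (volume : Measure ℝ)) 0)]
        with τ h0
      exact hτ τ h0
    · rw [lintegral_const_mul _ (by fun_prop)]
      gcongr
      refine (ENNReal.lintegral_mul_norm_pow_le (by fun_prop) (by fun_prop) (by norm_num)
        (by norm_num) (by norm_num)).trans ?_
      gcongr
  rw [← ENNReal.pow_le_pow_left_iff two_ne_zero]
  refine (sq_form_le hσ hf hfb hg hgb hh hhb).trans ((mul_le_mul_right hsum _).trans (le_of_eq ?_))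
  have e4 : ∀ x : ℝ≥0∞, (x ^ 4) ^ (1 / 2 : ℝ) = x ^ 2 := fun x => by
    rw [← ENNReal.rpow_natCast, ← ENNReal.rpow_natCast, ← ENNReal.rpow_mul]; norm_num
  rw [eLpNorm_two_sq, ENNReal.mul_rpow_of_nonneg _ _ (by norm_num),
    ENNReal.mul_rpow_of_nonneg _ _ (by norm_num), e4, e4,
    ENNReal.ofReal_rpow_of_pos (by positivity), ENNReal.ofReal_rpow_of_pos hC₁,
    ENNReal.ofReal_rpow_of_pos hC₂]
  have e5 : ENNReal.ofReal ((2 * C₁ * C₂) ^ (1 / 4 : ℝ) * Q ^ (1 / 4 : ℝ)) ^ 2 =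
      ENNReal.ofReal ((2 * Q) ^ (1 / 2 : ℝ)) * ENNReal.ofReal (C₁ ^ (1 / 2 : ℝ)) *
        ENNReal.ofReal (C₂ ^ (1 / 2 : ℝ)) := by
    rw [← ENNReal.ofReal_mul (by positivity), ← ENNReal.ofReal_mul (by positivity),
      ← ENNReal.ofReal_pow (by positivity), ← Real.mul_rpow (by positivity) (by positivity),
      ← Real.mul_rpow (by positivity) (by positivity),
      ← Real.mul_rpow (by positivity) (by positivity), ← Real.rpow_natCast, ← Real.rpow_mul
        (by positivity)]
    congr 1
    norm_num
    congr 1; ring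
  rw [mul_pow, mul_pow, mul_pow, e5]
  ring

end TrilinearOsc

/-! ### One-dimensional nonstationary phase. -/

namespace TrilinearOsc

open MeasureTheory Set
open scoped ENNReal ComplexConjugate

/-- `a` has derivatives `a₁`, `a₂` and obeys the bounds of an amplitude at scale `δ`. -/
structure IsAmplitude (A δ : ℝ) (a a₁ a₂ : ℝ → ℂ) : Prop where
  deriv₁ : ∀ x, HasDerivAt a (a₁ x) x
  deriv₂ : ∀ x, HasDerivAt a₁ (a₂ x) x
  bound₀ : ∀ x, ‖a x‖ ≤ A
  bound₁ : ∀ x, ‖a₁ x‖ ≤ A / δ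
  bound₂ : ∀ x, ‖a₂ x‖ ≤ A / δ ^ 2

theorem IsAmplitude.conj {A δ : ℝ} {a a₁ a₂ : ℝ → ℂ} (h : IsAmplitude A δ a a₁ a₂) :
    IsAmplitude A δ (fun x => conj (a x)) (fun x => conj (a₁ x)) (fun x => conj (a₂ x)) where
  deriv₁ x := (h.deriv₁ x).star
  deriv₂ x := (h.deriv₂ x).star
  bound₀ x := by simpa using h.bound₀ x
  bound₁ x := by simpa using h.bound₁ x
  bound₂ x := by simpa using h.bound₂ x

theorem IsAmplitude.mul {A B δ : ℝ} (hδ : 0 < δ) {a a₁ a₂ b b₁ b₂ : ℝ → ℂ}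
    (ha : IsAmplitude A δ a a₁ a₂) (hb : IsAmplitude B δ b b₁ b₂) :
    IsAmplitude (4 * A * B) δ (fun x => a x * b x) (fun x => a₁ x * b x + a x * b₁ x)
      (fun x => (a₂ x * b x + a₁ x * b₁ x) + (a₁ x * b₁ x + a x * b₂ x)) := by
  have hA : 0 ≤ A := (norm_nonneg _).trans (ha.bound₀ 0)
  have hB : 0 ≤ B := (norm_nonneg _).trans (hb.bound₀ 0)
  have key : ∀ {u v : ℂ} {s t : ℝ}, ‖u‖ ≤ s → ‖v‖ ≤ t → ‖u * v‖ ≤ s * t := fun {u v s t} hu hv => by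
    rw [norm_mul]; exact mul_le_mul hu hv (norm_nonneg _) ((norm_nonneg _).trans hu)
  refine ⟨fun x => (ha.deriv₁ x).mul (hb.deriv₁ x), fun x =>
    ((ha.deriv₂ x).mul (hb.deriv₁ x)).add ((ha.deriv₁ x).mul (hb.deriv₂ x)), fun x => ?_,
    fun x => ?_, fun x => ?_⟩
  · have := key (ha.bound₀ x) (hb.bound₀ x)
    nlinarith [mul_nonneg hA hB]
  · refine (norm_add_le_of_le (key (ha.bound₁ x) (hb.bound₀ x))
      (key (ha.bound₀ x) (hb.bound₁ x))).trans ?_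
    rw [show A / δ * B + A * (B / δ) = 2 * (A * B / δ) by ring,
      show 4 * A * B / δ = 4 * (A * B / δ) by ring]
    have : 0 ≤ A * B / δ := by positivity
    linarith
  · refine (norm_add_le_of_le
      (norm_add_le_of_le (key (ha.bound₂ x) (hb.bound₀ x)) (key (ha.bound₁ x) (hb.bound₁ x)))
      (norm_add_le_of_le (key (ha.bound₁ x) (hb.bound₁ x))
        (key (ha.bound₀ x) (hb.bound₂ x)))).trans (le_of_eq ?_)
    field_simp; ring

theorem integral_bound_of_support {T : Set ℝ} {x₀ δ M : ℝ} (hδ : 0 < δ)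
    (hT : T ⊆ Icc (x₀ - δ) (x₀ + δ)) {E : ℝ → ℂ} (hE : ∀ x ∉ T, E x = 0) (hM : 0 ≤ M)
    (hb : ∀ x ∈ T, ‖E x‖ ≤ M) : ‖∫ x, E x‖ ≤ M * (2 * δ) := by
  have h0 : ∀ x ∉ Icc (x₀ - δ) (x₀ + δ), E x = 0 := fun x hx => hE x fun h => hx (hT h)
  rw [← setIntegral_eq_integral_of_forall_compl_eq_zero h0]
  refine (norm_setIntegral_le_of_norm_le_const (C := M) (by simp) fun x _ => ?_).trans (le_of_eq ?_)
  · by_cases hx : x ∈ T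
    · exact hb x hx
    · simpa [hE x hx] using hM
  · rw [Real.volume_real_Icc_of_le (by linarith)]; ring

/-- Two integrations by parts in a one-dimensional oscillatory integral. -/
theorem nonstationary_phase {T : Set ℝ} (hT : IsClosed T) {x₀ δ A K m : ℝ} (hδ : 0 < δ)
    (hA : 0 ≤ A) (hK : 0 ≤ K) (hm : 0 < m) (hTs : T ⊆ Icc (x₀ - δ) (x₀ + δ)) {Φ P₁ P₂ P₃ : ℝ → ℝ}
    {a a₁ a₂ : ℝ → ℂ} (ha : IsAmplitude A δ a a₁ a₂) (h0 : ∀ x ∉ T, a x = 0)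
    (hΦ : ∀ x ∈ T, HasDerivAt Φ (P₁ x) x) (hP₁ : ∀ x ∈ T, HasDerivAt P₁ (P₂ x) x)
    (hP₂ : ∀ x ∈ T, HasDerivAt P₂ (P₃ x) x) (hb₁ : ∀ x ∈ T, m ≤ |P₁ x|)
    (hb₂ : ∀ x ∈ T, |P₂ x| ≤ K * m / δ) (hb₃ : ∀ x ∈ T, |P₃ x| ≤ K * m / δ ^ 2) :
    ‖∫ x, Complex.exp (Complex.I * Φ x) * a x‖ ≤
      4 * A * (1 + 4 * K + 3 * K ^ 2) * δ / (1 + (m * δ) ^ 2) := by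
  -- The phase is controlled only on `T`. Its complement is open, so off `T` the amplitude vanishes
  -- near the point together with its derivatives.
  have hev : ∀ x ∉ T, ∀ᶠ y in nhds x, y ∉ T := fun x hx => hT.isOpen_compl.mem_nhds hx
  have h1 : ∀ x ∉ T, a₁ x = 0 := fun x hx =>
    (ha.deriv₁ x).unique ((hasDerivAt_const x (0 : ℂ)).congr_of_eventuallyEq
      ((hev x hx).mono fun y hy => h0 y hy))
  have h2 : ∀ x ∉ T, a₂ x = 0 := fun x hx =>
    (ha.deriv₂ x).unique ((hasDerivAt_const x (0 : ℂ)).congr_of_eventuallyEq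
      ((hev x hx).mono fun y hy => h1 y hy))
  set e : ℝ → ℂ := fun x => Complex.exp (Complex.I * Φ x) with he
  have hen : ∀ x, ‖e x‖ = 1 := fun x => by
    simp only [he]; rw [mul_comm]; exact Complex.norm_exp_ofReal_mul_I _
  have hed : ∀ x ∈ T, HasDerivAt e (e x * (Complex.I * P₁ x)) x := fun x hx =>
    ((hΦ x hx).ofReal_comp.const_mul Complex.I).cexp
  -- The boundary term of two integrations by parts: its derivative is the integrand plus the error
  -- `E`, which has two powers of the phase derivative as gain.
  set W : ℝ → ℂ := fun x => e x * (-Complex.I * a x / P₁ x + a₁ x / P₁ x ^ 2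
    - a x * P₂ x / P₁ x ^ 3) with hW
  set E : ℝ → ℂ := fun x => e x * (a₂ x / P₁ x ^ 2 - 3 * a₁ x * P₂ x / P₁ x ^ 3
    - a x * P₃ x / P₁ x ^ 3 + 3 * a x * P₂ x ^ 2 / P₁ x ^ 4) with hE
  have hE0 : ∀ x ∉ T, E x = 0 := fun x hx => by simp [hE, h0 x hx, h1 x hx, h2 x hx]
  have hWd : ∀ x, HasDerivAt W (e x * a x + E x) x := by
    intro x
    by_cases hx : x ∈ T
    · have hP : (P₁ x : ℂ) ≠ 0 := by
        have := hm.trans_le (hb₁ x hx)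
        exact_mod_cast abs_pos.1 this
      have d1 := (hP₁ x hx).ofReal_comp
      have d2 := (hP₂ x hx).ofReal_comp
      have d := (hed x hx).mul (((((ha.deriv₁ x).const_mul (-Complex.I)).div d1 hP).add
        ((ha.deriv₂ x).div (d1.pow 2) (pow_ne_zero 2 hP))).sub
        (((ha.deriv₁ x).mul d2).div (d1.pow 3) (pow_ne_zero 3 hP)))
      refine d.congr_deriv ?_
      simp only [hE, Pi.add_apply, Pi.sub_apply, Pi.mul_apply, Pi.div_apply, Pi.pow_apply]
      field_simp
      push_cast
      ring_nf
      rw [Complex.I_sq]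
      ring
    · rw [hE0 x hx, h0 x hx, mul_zero, add_zero]
      refine (hasDerivAt_const x (0 : ℂ)).congr_of_eventuallyEq ((hev x hx).mono fun y hy => ?_)
      simp [hW, h0 y hy, h1 y hy]
  have hed' : ∀ x, DifferentiableAt ℝ (fun x => e x * a x) x := by
    intro x
    by_cases hx : x ∈ T
    · exact ((hed x hx).mul (ha.deriv₁ x)).differentiableAt
    · refine ((hasDerivAt_const x (0 : ℂ)).congr_of_eventuallyEq
        ((hev x hx).mono fun y hy => ?_)).differentiableAt
      simp [h0 y hy]
  have hcs : ∀ {F : ℝ → ℂ}, (∀ x ∉ T, F x = 0) → HasCompactSupport F := fun {F} hF =>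
    HasCompactSupport.intro isCompact_Icc fun x hx => hF x fun h => hx (hTs h)
  have hint0 : Integrable (fun x => e x * a x) :=
    (Differentiable.continuous hed').integrable_of_hasCompactSupport
      (hcs fun x hx => by simp [h0 x hx])
  have hWint : Integrable W :=
    (Differentiable.continuous fun x => (hWd x).differentiableAt).integrable_of_hasCompactSupport
      (hcs fun x hx => by simp [hW, h0 x hx, h1 x hx])
  set M : ℝ := A * (1 + 4 * K + 3 * K ^ 2) / (m * δ) ^ 2 with hM
  have hM0 : 0 ≤ M := by positivity
  have hEb : ∀ x ∈ T, ‖E x‖ ≤ M := by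
    intro x hx
    have hPm := hb₁ x hx
    have hP0 : 0 < |P₁ x| := hm.trans_le hPm
    simp only [hE]
    rw [norm_mul, hen, one_mul]
    have t1 : ‖a₂ x / P₁ x ^ 2‖ ≤ A / δ ^ 2 / m ^ 2 := by
      simp only [norm_div, norm_pow, Complex.norm_real, Real.norm_eq_abs]
      have := ha.bound₂ x
      gcongr
    have t2 : ‖3 * a₁ x * P₂ x / P₁ x ^ 3‖ ≤ 3 * (A / δ) * (K * m / δ) / m ^ 3 := by
      simp only [norm_div, norm_pow, norm_mul, Complex.norm_real, Real.norm_eq_abs]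
      have := ha.bound₁ x
      have := hb₂ x hx
      norm_num
      gcongr
    have t3 : ‖a x * P₃ x / P₁ x ^ 3‖ ≤ A * (K * m / δ ^ 2) / m ^ 3 := by
      simp only [norm_div, norm_pow, norm_mul, Complex.norm_real, Real.norm_eq_abs]
      have := ha.bound₀ x
      have := hb₃ x hx
      gcongr
    have t4 : ‖3 * a x * P₂ x ^ 2 / P₁ x ^ 4‖ ≤ 3 * A * (K * m / δ) ^ 2 / m ^ 4 := by
      simp only [norm_div, norm_pow, norm_mul, Complex.norm_real, Real.norm_eq_abs]
      have := ha.bound₀ x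
      have := hb₂ x hx
      norm_num only [Complex.norm_ofNat]
      gcongr
    refine (norm_add_le_of_le (norm_sub_le_of_le (norm_sub_le_of_le t1 t2) t3) t4).trans
      (le_of_eq ?_)
    rw [hM]; field_simp; ring
  have hEint : Integrable E := by
    -- No regularity of `P₃` is assumed; `E` is measurable as the derivative of `W` minus a
    -- continuous function.
    have hEm : AEStronglyMeasurable E volume := by
      have : E = fun x => deriv W x - e x * a x := by
        ext x; rw [(hWd x).deriv]; ring
      rw [this]
      exact (measurable_deriv W).aestronglyMeasurable.sub hint0.1
    rw [← integrableOn_iff_integrable_of_support_subset (s := Icc (x₀ - δ) (x₀ + δ))]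
    · refine Measure.integrableOn_of_bounded (M := M) (by simp) hEm
        (Filter.Eventually.of_forall fun x => ?_)
      by_cases hx : x ∈ T
      · exact hEb x hx
      · simpa [hE0 x hx] using hM0
    · intro x hx
      by_contra h
      exact hx (hE0 x fun h' => h (hTs h'))
  have hzero : (∫ x, e x * a x) = -∫ x, E x := by
    have := integral_eq_zero_of_hasDerivAt_of_integrable hWd (hint0.add hEint) hWint
    rw [integral_add hint0 hEint] at this
    exact eq_neg_of_add_eq_zero_left this
  have b1 : ‖∫ x, e x * a x‖ ≤ M * (2 * δ) := by
    rw [hzero, norm_neg]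
    exact integral_bound_of_support hδ hTs hE0 hM0 hEb
  have b2 : ‖∫ x, e x * a x‖ ≤ A * (2 * δ) :=
    integral_bound_of_support hδ hTs (fun x hx => by simp [h0 x hx]) hA fun x _ => by
      rw [norm_mul, hen, one_mul]; exact ha.bound₀ x
  -- Adding the trivial bound to (mδ)² times the integrated one gives the denominator 1 + (mδ)².
  rw [le_div_iff₀ (by positivity), mul_add, mul_one]
  have c1 : ‖∫ x, e x * a x‖ * (m * δ) ^ 2 ≤ A * (1 + 4 * K + 3 * K ^ 2) * (2 * δ) := by
    refine (mul_le_mul_of_nonneg_right b1 (by positivity)).trans (le_of_eq ?_)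
    rw [hM]; field_simp
  have c2 : A * (2 * δ) ≤ A * (1 + 4 * K + 3 * K ^ 2) * (2 * δ) := by
    have : A * 1 ≤ A * (1 + 4 * K + 3 * K ^ 2) := by gcongr; nlinarith
    nlinarith
  linarith

end TrilinearOsc

/-! ### Second differences of the phase and decay of the T T* kernel. -/

namespace TrilinearOsc

open MeasureTheory Set
open scoped ENNReal ComplexConjugate ContDiff

/-- The derivative in the direction `v`. -/
noncomputable def pd {E : Type*} [NormedAddCommGroup E] [NormedSpace ℝ E] (v : ℝ × ℝ) (F : ℝ × ℝ → E) :
    ℝ × ℝ → E := fun z => fderiv ℝ F z v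

section pd
variable {E : Type*} [NormedAddCommGroup E] [NormedSpace ℝ E]

theorem pd_contDiffOn {U : Set (ℝ × ℝ)} (hU : IsOpen U) {F : ℝ × ℝ → E} (hF : ContDiffOn ℝ ∞ F U)
    (v : ℝ × ℝ) : ContDiffOn ℝ ∞ (pd v F) U :=
  (hF.fderiv_of_isOpen hU (by simp)).clm_apply contDiffOn_const

theorem pd_congr {U : Set (ℝ × ℝ)} (hU : IsOpen U) {F G : ℝ × ℝ → E} (h : EqOn F G U)
    (v : ℝ × ℝ) : EqOn (pd v F) (pd v G) U := fun z hz => by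
  unfold pd
  rw [(h.eventuallyEq_of_mem (hU.mem_nhds hz)).fderiv_eq]

theorem pd_comm {U : Set (ℝ × ℝ)} (hU : IsOpen U) {F : ℝ × ℝ → E} (hF : ContDiffOn ℝ ∞ F U)
    (v w : ℝ × ℝ) : EqOn (pd v (pd w F)) (pd w (pd v F)) U := fun z hz => by
  have hFz := hF.contDiffAt (hU.mem_nhds hz)
  have hd : DifferentiableAt ℝ (fderiv ℝ F) z :=
    ((hF.fderiv_of_isOpen hU (m := ∞) (by simp)).contDiffAt (hU.mem_nhds hz)).differentiableAt
      (by simp)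
  have key : ∀ v w, pd v (pd w F) z = fderiv ℝ (fderiv ℝ F) z v w := fun v w => by
    unfold pd
    rw [fderiv_clm_apply hd (differentiableAt_const _)]
    simp
  rw [key, key]
  exact hFz.isSymmSndFDerivAt (by simpa using ENat.LEInfty.out) v w

theorem pd_neg (v : ℝ × ℝ) (F : ℝ × ℝ → E) : pd v (fun z => -F z) = fun z => -pd v F z := by
  ext z; simp [pd]

theorem hasDerivAt_line {U : Set (ℝ × ℝ)} (hU : IsOpen U) {F : ℝ × ℝ → E}
    (hF : ContDiffOn ℝ ∞ F U) (z v : ℝ × ℝ) {x : ℝ} (hz : z + x • v ∈ U) :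
    HasDerivAt (fun x : ℝ => F (z + x • v)) (pd v F (z + x • v)) x := by
  have h1 : HasFDerivAt F (fderiv ℝ F (z + x • v)) (z + x • v) :=
    ((hF.contDiffAt (hU.mem_nhds hz)).differentiableAt (by simp)).hasFDerivAt
  have h2 : HasDerivAt (fun x : ℝ => z + x • v) v x := by
    simpa using ((hasDerivAt_id x).smul_const v).const_add z
  exact h1.comp_hasDerivAt x h2

end pd

theorem DirConvex.add_smul_mem {v : ℝ × ℝ} {C : Set (ℝ × ℝ)} (hC : DirConvex v C) {z : ℝ × ℝ}
    {b : ℝ} (h0 : z ∈ C) (h1 : z + b • v ∈ C) {s : ℝ} (hs : s ∈ Icc (0 : ℝ) 1) :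
    z + s • b • v ∈ C := by
  refine hC z h0 (z + b • v) h1 ⟨-b, by simp⟩ ?_
  rw [segment_eq_image']
  exact ⟨s, hs, by simp⟩

/-- The second difference of `R` over the parallelogram spanned by `p` and `q`. -/
noncomputable def secondDiff (R : ℝ × ℝ → ℝ) (p q z : ℝ × ℝ) : ℝ :=
  (R (z + p + q) - R (z + q)) - (R (z + p) - R z)

/-- Two applications of the mean value theorem. The two sides parallel to w lie in C by w-convexity;
the chord joining the points at parameter s on these sides is parallel to v, so it lies in C by
v-convexity. -/
theorem exists_secondDiff_eq {U C : Set (ℝ × ℝ)} (hU : IsOpen U) (hCU : C ⊆ U) {v w : ℝ × ℝ}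
    (hv : DirConvex v C) (hw : DirConvex w C) {R : ℝ × ℝ → ℝ} (hR : ContDiffOn ℝ ∞ R U)
    {z : ℝ × ℝ} {a b : ℝ} (h00 : z ∈ C) (h10 : z + a • v ∈ C) (h01 : z + b • w ∈ C)
    (h11 : z + a • v + b • w ∈ C) :
    ∃ ξ ∈ C, secondDiff R (a • v) (b • w) z = a * b * pd v (pd w R) ξ := by
  have m0 : ∀ s ∈ Icc (0 : ℝ) 1, z + s • b • w ∈ C := fun s hs => hw.add_smul_mem h00 h01 hs
  have m1 : ∀ s ∈ Icc (0 : ℝ) 1, z + a • v + s • b • w ∈ C := fun s hs =>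
    hw.add_smul_mem h10 h11 hs
  have pds : ∀ (c : ℝ) (u : ℝ × ℝ) (F : ℝ × ℝ → ℝ) y, pd (c • u) F y = c * pd u F y :=
    fun c u F y => by simp [pd]
  have d : ∀ s ∈ Icc (0 : ℝ) 1, HasDerivAt
      (fun s : ℝ => R (z + a • v + s • b • w) - R (z + s • b • w))
      (b * pd w R (z + a • v + s • b • w) - b * pd w R (z + s • b • w)) s := fun s hs => by
    have := (hasDerivAt_line hU hR _ _ (hCU (m1 s hs))).sub
      (hasDerivAt_line hU hR _ _ (hCU (m0 s hs)))
    rw [pds, pds] at this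
    exact this
  obtain ⟨s, hs, hs'⟩ := exists_hasDerivAt_eq_slope _ _ (zero_lt_one' ℝ)
    (fun s hs => (d s hs).continuousAt.continuousWithinAt)
    (fun s hs => d s (Ioo_subset_Icc_self hs))
  have hs1 := Ioo_subset_Icc_self hs
  have m2 : ∀ t ∈ Icc (0 : ℝ) 1, z + s • b • w + t • a • v ∈ C := fun t ht =>
    hv.add_smul_mem (m0 s hs1) (by convert m1 s hs1 using 1; abel) ht
  have d2 : ∀ t ∈ Icc (0 : ℝ) 1, HasDerivAt
      (fun t : ℝ => pd w R (z + s • b • w + t • a • v))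
      (a * pd v (pd w R) (z + s • b • w + t • a • v)) t := fun t ht => by
    have := hasDerivAt_line hU (pd_contDiffOn hU hR w) _ _ (hCU (m2 t ht))
    rw [pds] at this
    exact this
  obtain ⟨t, ht, ht'⟩ := exists_hasDerivAt_eq_slope _ _ (zero_lt_one' ℝ)
    (fun t ht => (d2 t ht).continuousAt.continuousWithinAt)
    (fun t ht => d2 t (Ioo_subset_Icc_self ht))
  refine ⟨_, m2 t (Ioo_subset_Icc_self ht), ?_⟩
  simp only [zero_smul, one_smul, add_zero, sub_zero, div_one] at hs' ht'
  unfold secondDiff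
  rw [← hs', mul_comm a b, mul_assoc, ht', show z + s • b • w + a • v = z + a • v + s • b • w by abel]
  ring

/-- The oscillatory kernel `e^{iλS} φ`. -/
noncomputable def oscKernel (lam : ℝ) (S : ℝ × ℝ → ℝ) (φ : ℝ × ℝ → ℂ) : ℝ × ℝ → ℂ :=
  fun z => Complex.exp (Complex.I * ((lam * S z : ℝ) : ℂ)) * φ z

/-- The multiplicative second difference of `σ` over the parallelogram spanned by `p` and `q`. -/
noncomputable def mulDiff (σ : ℝ × ℝ → ℂ) (p q z : ℝ × ℝ) : ℂ :=
  conj (σ (z + p)) * σ z * conj (conj (σ (z + p + q)) * σ (z + q))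

theorem mulDiff_oscKernel (lam : ℝ) (S : ℝ × ℝ → ℝ) (φ : ℝ × ℝ → ℂ) (p q z : ℝ × ℝ) :
    mulDiff (oscKernel lam S φ) p q z =
      Complex.exp (Complex.I * ((lam * secondDiff S p q z : ℝ) : ℂ)) * mulDiff φ p q z := by
  have hc : ∀ t : ℝ, conj (Complex.exp (Complex.I * t)) = Complex.exp (-(Complex.I * t)) :=
    fun t => by rw [← Complex.exp_conj]; simp
  have hc' : ∀ t : ℝ, conj (Complex.exp (-(Complex.I * t))) = Complex.exp (Complex.I * t) :=
    fun t => by rw [← hc, RCLike.conj_conj]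
  unfold mulDiff oscKernel secondDiff
  simp only [map_mul, hc, hc', RCLike.conj_conj]
  rw [show Complex.I * ((lam * (S (z + p + q) - S (z + q) - (S (z + p) - S z)) : ℝ) : ℂ) =
    -(Complex.I * ((lam * S (z + p) : ℝ) : ℂ)) + Complex.I * ((lam * S z : ℝ) : ℂ) +
    (Complex.I * ((lam * S (z + p + q) : ℝ) : ℂ) + -(Complex.I * ((lam * S (z + q) : ℝ) : ℂ))) by
      push_cast; ring]
  simp only [Complex.exp_add]
  ring

/-- A move of length 2δ along e leaves the support, so the bound on the derivative controls the size
of φ. -/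
theorem bound_of_width {φ : ℝ × ℝ → ℂ} (hφ : ContDiff ℝ ∞ φ) {A δ : ℝ} (hδ : 0 < δ) {e : ℝ × ℝ}
    (hw : ∀ (z : ℝ × ℝ) (x x' : ℝ), z + x • e ∈ tsupport φ → z + x' • e ∈ tsupport φ → |x - x'| ≤ δ)
    (h1 : ∀ z, ‖pd e φ z‖ ≤ A / δ) (z : ℝ × ℝ) : ‖φ z‖ ≤ 2 * A := by
  have hA : 0 ≤ A / δ := (norm_nonneg _).trans (h1 0)
  have hA' : 0 ≤ A := by simpa [hδ.ne'] using mul_nonneg hA hδ.le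
  by_cases hz : z ∈ tsupport φ
  · have h2 : z + (2 * δ) • e ∉ tsupport φ := fun h => by
      have := hw z (2 * δ) 0 h (by simpa using hz)
      rw [sub_zero, abs_of_pos (by linarith)] at this
      linarith
    have := Convex.norm_image_sub_le_of_norm_hasDerivWithin_le (C := A / δ)
      (f := fun x : ℝ => φ (z + x • e)) (s := univ) (x := 2 * δ) (y := 0)
      (fun x _ => (hasDerivAt_line isOpen_univ hφ.contDiffOn z e (mem_univ _)).hasDerivWithinAt)
      (fun x _ => h1 _) convex_univ (mem_univ _) (mem_univ _)
    simp only [zero_smul, add_zero, image_eq_zero_of_notMem_tsupport h2, sub_zero, zero_sub,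
      norm_neg, Real.norm_eq_abs, abs_of_pos (by linarith : 0 < 2 * δ)] at this
    refine this.trans (le_of_eq ?_)
    field_simp
  · rw [image_eq_zero_of_notMem_tsupport hz, norm_zero]; linarith

theorem isAmplitude_line {φ : ℝ × ℝ → ℂ} (hφ : ContDiff ℝ ∞ φ) {A δ : ℝ} (hδ : 0 < δ) {e : ℝ × ℝ}
    (hw : ∀ (z : ℝ × ℝ) (x x' : ℝ), z + x • e ∈ tsupport φ → z + x' • e ∈ tsupport φ → |x - x'| ≤ δ)
    (h1 : ∀ z, ‖pd e φ z‖ ≤ A / δ) (h2 : ∀ z, ‖pd e (pd e φ) z‖ ≤ A / δ ^ 2) (z : ℝ × ℝ) :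
    IsAmplitude (2 * A) δ (fun x => φ (z + x • e)) (fun x => pd e φ (z + x • e))
      (fun x => pd e (pd e φ) (z + x • e)) := by
  have hA : 0 ≤ A / δ := (norm_nonneg _).trans (h1 0)
  have hA' : 0 ≤ A := by simpa [hδ.ne'] using mul_nonneg hA hδ.le
  refine ⟨fun x => hasDerivAt_line isOpen_univ hφ.contDiffOn z e (mem_univ _), fun x =>
    hasDerivAt_line isOpen_univ (pd_contDiffOn isOpen_univ hφ.contDiffOn e) z e (mem_univ _),
    fun x => bound_of_width hφ hδ hw h1 _, fun x => (h1 _).trans ?_, fun x => (h2 _).trans ?_⟩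
  · gcongr; linarith
  · gcongr; linarith

/-- Decay of the oscillatory integral along `e` of the second difference over a parallelogram. -/
theorem mulDiff_integral_le {A B c : ℝ} (hA : 0 < A) (hB : 0 < B) (hc : 0 < c) :
    ∃ M : ℝ, 0 < M ∧ ∀ (δ μ : ℝ), 0 < δ → 0 < μ → ∀ (φ : ℝ × ℝ → ℂ), ContDiff ℝ ∞ φ →
      ∀ e v w : ℝ × ℝ,
      (∀ (z : ℝ × ℝ) (x x' : ℝ), z + x • e ∈ tsupport φ → z + x' • e ∈ tsupport φ →
        |x - x'| ≤ δ) →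
      (∀ z, ‖pd e φ z‖ ≤ A / δ) → (∀ z, ‖pd e (pd e φ) z‖ ≤ A / δ ^ 2) →
      ∀ (U C : Set (ℝ × ℝ)) (S : ℝ × ℝ → ℝ), IsOpen U → ContDiffOn ℝ ∞ S U →
      tsupport φ ⊆ C → C ⊆ U → DirConvex v C → DirConvex w C →
      (∀ z ∈ C, c * μ ≤ |pd v (pd w (pd e S)) z|) →
      (∀ z ∈ C, |pd e (pd v (pd w (pd e S))) z| ≤ B * (μ / δ)) →
      (∀ z ∈ C, |pd e (pd e (pd v (pd w (pd e S)))) z| ≤ B * (μ / δ ^ 2)) →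
      ∀ lam : ℝ, lam ≠ 0 → ∀ a b : ℝ, a ≠ 0 → b ≠ 0 → ∀ z,
        ‖∫ x : ℝ, mulDiff (oscKernel lam S φ) (a • v) (b • w) (z + x • e)‖ ≤
          M * δ / (1 + (|lam| * μ * |a| * |b| * δ) ^ 2) := by
  set K : ℝ := B / c with hK
  have hK0 : 0 < K := by positivity
  -- The amplitude is a product of four translates of φ or its conjugate, each with constant 2A by
  -- `isAmplitude_line`; each of the three multiplications costs a factor 4.
  set A' : ℝ := 4 * (4 * (2 * A) * (2 * A)) * (4 * (2 * A) * (2 * A)) with hA'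
  have hA'0 : 0 < A' := by positivity
  set M₀ : ℝ := 4 * A' * (1 + 4 * K + 3 * K ^ 2) with hM₀
  have hM₀0 : 0 < M₀ := by positivity
  refine ⟨M₀ * (1 + 1 / c ^ 2), by positivity, ?_⟩
  intro δ μ hδ hμ φ hφ e v w hw hφ1 hφ2 U C S hU hS hTC hCU hv hwC hS0 hS1 hS2 lam hlam a b ha hb z
  -- The positions at which all four vertices of the parallelogram lie in the support, as the mean
  -- value theorem requires.
  set T : Set ℝ := {x | z + x • e + a • v ∈ tsupport φ ∧ z + x • e ∈ tsupport φ ∧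
    z + x • e + a • v + b • w ∈ tsupport φ ∧ z + x • e + b • w ∈ tsupport φ} with hT
  have hcl : IsClosed (tsupport φ) := isClosed_tsupport φ
  have hTcl : IsClosed T :=
    (hcl.preimage (by fun_prop : Continuous fun x : ℝ => z + x • e + a • v)).inter
    ((hcl.preimage (by fun_prop : Continuous fun x : ℝ => z + x • e)).inter
    ((hcl.preimage (by fun_prop : Continuous fun x : ℝ => z + x • e + a • v + b • w)).inter
    (hcl.preimage (by fun_prop : Continuous fun x : ℝ => z + x • e + b • w))))
  obtain ⟨x₀, hx₀⟩ : ∃ x₀, T ⊆ Icc (x₀ - δ) (x₀ + δ) := by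
    rcases T.eq_empty_or_nonempty with h | ⟨x₀, hx₀⟩
    · exact ⟨0, by simp [h]⟩
    · refine ⟨x₀, fun x hx => ?_⟩
      have := abs_le.1 (hw z x x₀ hx.2.1 hx₀.2.1)
      constructor <;> linarith
  have hamp : ∀ p : ℝ × ℝ, IsAmplitude (2 * A) δ (fun x => φ (z + x • e + p))
      (fun x => pd e φ (z + x • e + p)) (fun x => pd e (pd e φ) (z + x • e + p)) := fun p => by
    have := isAmplitude_line hφ hδ hw hφ1 hφ2 (z + p)
    simpa only [add_right_comm z p] using this
  have hamp0 := isAmplitude_line hφ hδ hw hφ1 hφ2 z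
  have hamp1 := ((hamp (a • v)).conj.mul hδ hamp0).mul hδ
    (((hamp (a • v + b • w)).conj.mul hδ (hamp (b • w))).conj)
  simp only [← add_assoc] at hamp1
  set m : ℝ := c * (|lam| * μ * |a| * |b|) with hm
  have hl : 0 < |lam| := abs_pos.2 hlam
  have ha' : 0 < |a| := abs_pos.2 ha
  have hb' : 0 < |b| := abs_pos.2 hb
  have hm0 : 0 < m := by positivity
  have hd : ∀ (R : ℝ × ℝ → ℝ), ContDiffOn ℝ ∞ R U → ∀ x ∈ T,
      HasDerivAt (fun x : ℝ => lam * secondDiff R (a • v) (b • w) (z + x • e))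
        (lam * secondDiff (pd e R) (a • v) (b • w) (z + x • e)) x := by
    intro R hR x hx
    have key : ∀ p : ℝ × ℝ, z + x • e + p ∈ tsupport φ →
        HasDerivAt (fun x : ℝ => R (z + x • e + p)) (pd e R (z + x • e + p)) x := fun p hp => by
      have := hasDerivAt_line hU hR (z + p) e (x := x)
        (by rw [add_right_comm]; exact hCU (hTC hp))
      simpa only [add_right_comm z p] using this
    have k1 := key (a • v + b • w) (by rw [← add_assoc]; exact hx.2.2.1)
    simp only [← add_assoc] at k1
    have k4 := hasDerivAt_line hU hR z e (x := x) (hCU (hTC hx.2.1))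
    exact ((k1.sub (key (b • w) hx.2.2.2)).sub ((key (a • v) hx.1).sub k4)).const_mul lam
  have hmv : ∀ (R : ℝ × ℝ → ℝ), ContDiffOn ℝ ∞ R U → ∀ x ∈ T, ∃ ξ ∈ C,
      |lam * secondDiff R (a • v) (b • w) (z + x • e)| =
        |lam| * |a| * |b| * |pd v (pd w R) ξ| := by
    intro R hR x hx
    obtain ⟨ξ, hξ, h⟩ := exists_secondDiff_eq hU hCU hv hwC hR (hTC hx.2.1) (hTC hx.1)
      (hTC hx.2.2.2) (hTC hx.2.2.1)
    refine ⟨ξ, hξ, ?_⟩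
    rw [h]; simp only [abs_mul]; ring
  have s1 := pd_contDiffOn hU hS e
  have s2 := pd_contDiffOn hU s1 e
  have s3 := pd_contDiffOn hU s2 e
  -- Differentiating the phase puts the extra e-derivatives innermost, whereas the hypotheses bound
  -- e-derivatives of the full third-order derivative.
  have comm3 : ∀ {R : ℝ × ℝ → ℝ}, ContDiffOn ℝ ∞ R U →
      EqOn (pd v (pd w (pd e R))) (pd e (pd v (pd w R))) U := fun {R} hR =>
    (pd_congr hU (pd_comm hU hR w e) v).trans (pd_comm hU (pd_contDiffOn hU hR w) v e)
  have main := nonstationary_phase hTcl hδ hA'0.le hK0.le hm0 hx₀ hamp1 (fun x hx => by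
      by_contra hne
      refine hx ⟨?_, ?_, ?_, ?_⟩ <;>
      · by_contra h
        exact hne (by simp [image_eq_zero_of_notMem_tsupport h]))
    (hd S hS) (hd _ s1) (hd _ s2) (fun x hx => by
      obtain ⟨ξ, hξ, h⟩ := hmv _ s1 x hx
      rw [h, hm]
      calc c * (|lam| * μ * |a| * |b|) = |lam| * |a| * |b| * (c * μ) := by ring
        _ ≤ _ := by gcongr; exact hS0 ξ hξ)
    (fun x hx => by
      obtain ⟨ξ, hξ, h⟩ := hmv _ s2 x hx
      rw [h, comm3 s1 (hCU hξ)]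
      calc _ ≤ |lam| * |a| * |b| * (B * (μ / δ)) := by gcongr; exact hS1 ξ hξ
        _ = _ := by rw [hK, hm]; field_simp)
    (fun x hx => by
      obtain ⟨ξ, hξ, h⟩ := hmv _ s3 x hx
      rw [h, comm3 s2 (hCU hξ), pd_congr hU (comm3 s1) e (hCU hξ)]
      calc _ ≤ |lam| * |a| * |b| * (B * (μ / δ ^ 2)) := by gcongr; exact hS2 ξ hξ
        _ = _ := by rw [hK, hm]; field_simp)
  simp only [mulDiff_oscKernel]
  refine (le_of_eq_of_le ?_ main).trans ?_
  · rfl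
  rw [div_le_div_iff₀ (by positivity) (by positivity), ← hM₀]
  set N := |lam| * μ * |a| * |b|
  -- Since m = cN, the factor 1 + 1/c² absorbs the passage from m to N in the denominator.
  have : 1 + (N * δ) ^ 2 ≤ (1 + 1 / c ^ 2) * (1 + (m * δ) ^ 2) := by
    have e1 : (1 + 1 / c ^ 2) * (1 + (m * δ) ^ 2) =
        1 + 1 / c ^ 2 + (m * δ) ^ 2 + (N * δ) ^ 2 := by
      rw [hm]; field_simp; ring
    rw [e1]
    have : 0 ≤ 1 / c ^ 2 := by positivity
    nlinarith [sq_nonneg (m * δ)]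
  calc M₀ * δ * (1 + (N * δ) ^ 2) ≤ M₀ * δ * ((1 + 1 / c ^ 2) * (1 + (m * δ) ^ 2)) := by gcongr
    _ = _ := by ring

end TrilinearOsc

/-! ### The three edges of the exponent triangle, related by shears. -/

namespace TrilinearOsc

open MeasureTheory Set
open scoped ENNReal ComplexConjugate ContDiff

theorem lintegral_lorentz {L κ : ℝ} (hL : 0 < L) (hκ : 0 < κ) (y : ℝ) :
    ∫⁻ y', ENNReal.ofReal (L / (1 + (κ * |y' - y|) ^ 2)) = ENNReal.ofReal (L * Real.pi / κ) := by
  have e : ∀ y', L / (1 + (κ * |y' - y|) ^ 2) = L * (1 + (κ * (y' - y)) ^ 2)⁻¹ := fun y' => by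
    rw [mul_pow, sq_abs, ← mul_pow]; rfl
  simp only [e]
  rw [lintegral_sub_right_eq_self (fun y => ENNReal.ofReal (L * (1 + (κ * y) ^ 2)⁻¹)) y,
    ← ofReal_integral_eq_lintegral_ofReal]
  · rw [integral_const_mul, Measure.integral_comp_mul_left (fun x => (1 + x ^ 2)⁻¹) κ,
      integral_univ_inv_one_add_sq, abs_of_pos (by positivity), smul_eq_mul]
    congr 1; field_simp
  · exact ((integrable_inv_one_add_sq.comp_mul_left' hκ.ne').const_mul L)
  · exact Filter.Eventually.of_forall fun x => by positivity

/-- The second differences of `σ` decay after integration along `e`. -/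
def HasDecay (σ : ℝ × ℝ → ℂ) (e v w : ℝ × ℝ) (M N δ : ℝ) : Prop :=
  ∀ a b : ℝ, a ≠ 0 → b ≠ 0 → ∀ z,
    ‖∫ x : ℝ, mulDiff σ (a • v) (b • w) (z + x • e)‖ ≤ M * δ / (1 + (N * |a| * |b| * δ) ^ 2)

/-- The trilinear form with kernel `σ`. -/
noncomputable def trilinear (σ : ℝ × ℝ → ℂ) (f g h : ℝ → ℂ) : ℂ :=
  ∫ z : ℝ × ℝ, σ z * (f z.1 * g z.2 * h (z.1 + z.2))

/-- The form with kernel `σ` obeys a bound on bounded measurable functions. -/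
def HasBound (σ : ℝ × ℝ → ℂ) (K p q r : ℝ) : Prop :=
  ∀ f g h : ℝ → ℂ, Measurable f → (∃ C, ∀ x, ‖f x‖ ≤ C) → Measurable g →
    (∃ C, ∀ x, ‖g x‖ ≤ C) → Measurable h → (∃ C, ∀ x, ‖h x‖ ≤ C) →
    ‖trilinear σ f g h‖ₑ ≤ ENNReal.ofReal K * eLpNorm f (ENNReal.ofReal p) volume *
      eLpNorm g (ENNReal.ofReal q) volume * eLpNorm h (ENNReal.ofReal r) volume

/-- The integral in y' of the assumed decay is πM/(N|τ|): the width δ cancels, so Schur's test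
applies with Q = πM/N. -/
theorem trilinear_edge_of_decay {p q : ℝ} (hp : 2 < p) (hq : 2 < q)
    (hpq : 1 / p + 1 / q = 3 / 4) :
    ∃ C : ℝ, 0 < C ∧ ∀ (σ : ℝ × ℝ → ℂ), BddKernel σ → ∀ M N δ : ℝ, 0 < M → 0 < N → 0 < δ →
      (∀ τ ≠ 0, ∀ y y', y' ≠ y →
        ‖∫ x, diffKernel σ τ (x, y) * conj (diffKernel σ τ (x, y'))‖ ≤
          M * δ / (1 + (N * |τ| * |y' - y| * δ) ^ 2)) →
      HasBound σ (C * (M / N) ^ (1 / 4 : ℝ)) p q 2 := by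
  obtain ⟨C, hC, H⟩ := trilinear_edge hp hq hpq
  refine ⟨C * Real.pi ^ (1 / 4 : ℝ), by positivity, ?_⟩
  intro σ hσ M N δ hM hN hδ hdec f g h hf hfb hg hgb hh hhb
  have := H σ hσ (Real.pi * (M / N)) (by positivity) (fun τ hτ y => ?_) f g h hf hfb hg hgb hh hhb
  · rw [Real.mul_rpow (by positivity) (by positivity), ← mul_assoc] at this
    simpa [trilinear] using this
  · have hτ' : 0 < |τ| := abs_pos.2 hτ
    refine (lintegral_mono_ae (g := fun y' =>
      ENNReal.ofReal (M * δ / (1 + (N * |τ| * δ * |y' - y|) ^ 2))) ?_).trans ?_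
    · filter_upwards [compl_mem_ae_iff.2 (measure_singleton (μ := (volume : Measure ℝ)) y)]
        with y' hy'
      rw [← ofReal_norm]
      refine ENNReal.ofReal_le_ofReal ((hdec τ hτ y y' hy').trans (le_of_eq ?_))
      congr 3; ring
    · rw [lintegral_lorentz (by positivity) (by positivity)]
      refine ENNReal.ofReal_le_ofReal (le_of_eq ?_)
      field_simp

/-- The shear `(x, y) ↦ (x + y, -y)`. -/
def shearFst : ℝ × ℝ ≃ᵐ ℝ × ℝ where
  toFun z := (z.1 + z.2, -z.2)
  invFun w := (w.1 + w.2, -w.2)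
  left_inv z := by simp
  right_inv w := by simp
  measurable_toFun := by dsimp; fun_prop
  measurable_invFun := by dsimp; fun_prop

theorem measurePreserving_shearFst : MeasurePreserving shearFst volume volume :=
  ((MeasurePreserving.id (volume : Measure ℝ)).prod
    (Measure.measurePreserving_neg (volume : Measure ℝ))).comp
    (measurePreserving_add_prod (volume : Measure ℝ) volume)

/-- The shear `(x, y) ↦ (-y, x + y)`. -/
def shearSnd : ℝ × ℝ ≃ᵐ ℝ × ℝ := shearFst.trans MeasurableEquiv.prodComm

theorem measurePreserving_shearSnd : MeasurePreserving shearSnd volume volume :=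
  (Measure.measurePreserving_swap (μ := (volume : Measure ℝ)) (ν := (volume : Measure ℝ))).comp
    measurePreserving_shearFst

theorem norm_le_two_mul_shearFst (z : ℝ × ℝ) : ‖z‖ ≤ 2 * ‖(z.1 + z.2, -z.2)‖ := by
  simp only [Prod.norm_def, Real.norm_eq_abs, abs_neg]
  have h1 := le_max_left |z.1 + z.2| |z.2|
  have h2 := le_max_right |z.1 + z.2| |z.2|
  refine max_le ?_ (by linarith [abs_nonneg z.2])
  have := abs_sub (z.1 + z.2) z.2
  rw [add_sub_cancel_right] at this
  linarith

theorem BddKernel.comp_shearFst {σ : ℝ × ℝ → ℂ} (hσ : BddKernel σ) : BddKernel (σ ∘ shearFst) :=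
  hσ.comp shearFst.measurable two_pos norm_le_two_mul_shearFst

theorem BddKernel.comp_shearSnd {σ : ℝ × ℝ → ℂ} (hσ : BddKernel σ) : BddKernel (σ ∘ shearSnd) :=
  hσ.comp shearSnd.measurable two_pos fun z => (norm_le_two_mul_shearFst z).trans (by
    change _ ≤ 2 * ‖(-z.2, z.1 + z.2)‖
    simp only [Prod.norm_def, max_comm, le_refl])

theorem trilinear_comp_shearFst (σ : ℝ × ℝ → ℂ) (f g h : ℝ → ℂ) :
    trilinear σ f g h = trilinear (σ ∘ shearFst) h (fun y => g (-y)) f := by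
  unfold trilinear
  rw [← measurePreserving_shearFst.integral_comp']
  refine integral_congr_ae (Filter.Eventually.of_forall fun z => ?_)
  change σ (shearFst z) * (f (z.1 + z.2) * g (-z.2) * h (z.1 + z.2 + -z.2)) =
    σ (shearFst z) * (h z.1 * g (-z.2) * f (z.1 + z.2))
  rw [add_neg_cancel_right]
  ring

theorem trilinear_comp_shearSnd (σ : ℝ × ℝ → ℂ) (f g h : ℝ → ℂ) :
    trilinear σ f g h = trilinear (σ ∘ shearSnd) h (fun y => f (-y)) g := by
  unfold trilinear
  rw [← measurePreserving_shearSnd.integral_comp']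
  refine integral_congr_ae (Filter.Eventually.of_forall fun z => ?_)
  change σ (shearSnd z) * (f (-z.2) * g (z.1 + z.2) * h (-z.2 + (z.1 + z.2))) =
    σ (shearSnd z) * (h z.1 * f (-z.2) * g (z.1 + z.2))
  rw [show -z.2 + (z.1 + z.2) = z.1 by ring]
  ring

theorem eLpNorm_comp_neg {f : ℝ → ℂ} (hf : Measurable f) (p : ℝ≥0∞) :
    eLpNorm (fun y => f (-y)) p volume = eLpNorm f p volume :=
  eLpNorm_comp_measurePreserving hf.aestronglyMeasurable
    (Measure.measurePreserving_neg (volume : Measure ℝ))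

theorem hasBound_third {p q : ℝ} (hp : 2 < p) (hq : 2 < q) (hpq : 1 / p + 1 / q = 3 / 4) :
    ∃ C : ℝ, 0 < C ∧ ∀ (σ : ℝ × ℝ → ℂ), BddKernel σ → ∀ M N δ : ℝ, 0 < M → 0 < N → 0 < δ →
      HasDecay σ (1, 0) (-1, 1) (0, 1) M N δ → HasBound σ (C * (M / N) ^ (1 / 4 : ℝ)) p q 2 := by
  obtain ⟨C, hC, H⟩ := trilinear_edge_of_decay hp hq hpq
  refine ⟨C, hC, fun σ hσ M N δ hM hN hδ hdec => H σ hσ M N δ hM hN hδ fun τ hτ y y' hy => ?_⟩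
  -- The shift by τ along (1,-1) is the shift by -τ along (-1,1).
  have := hdec (-τ) (y' - y) (neg_ne_zero.2 hτ) (sub_ne_zero.2 hy) (0, y)
  rw [abs_neg] at this
  refine (le_of_eq ?_).trans this
  congr 2; ext x
  simp only [diffKernel, mulDiff, Prod.smul_mk, Prod.mk_add_mk, smul_eq_mul]
  ring_nf

/-- The shear (x, y) ↦ (x + y, -y) interchanges f and h and reflects g. It fixes (1,0) and
interchanges (0,1) with (1,-1), so the two difference directions swap roles. -/
theorem hasBound_first {q r : ℝ} (hq : 2 < q) (hr : 2 < r) (hqr : 1 / q + 1 / r = 3 / 4) :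
    ∃ C : ℝ, 0 < C ∧ ∀ (σ : ℝ × ℝ → ℂ), BddKernel σ → ∀ M N δ : ℝ, 0 < M → 0 < N → 0 < δ →
      HasDecay σ (1, 0) (0, 1) (-1, 1) M N δ → HasBound σ (C * (M / N) ^ (1 / 4 : ℝ)) 2 q r := by
  obtain ⟨C, hC, H⟩ := trilinear_edge_of_decay hr hq (by rw [add_comm]; exact hqr)
  refine ⟨C, hC, fun σ hσ M N δ hM hN hδ hdec f g h hf hfb hg hgb hh hhb => ?_⟩
  rw [trilinear_comp_shearFst]
  refine (H _ hσ.comp_shearFst M N δ hM hN hδ (fun τ hτ y y' hy => ?_) h (fun y => g (-y)) f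
    hh hhb (by fun_prop) (hgb.imp fun C hC x => hC _) hf hfb).trans (le_of_eq ?_)
  · have := hdec τ (-(y' - y)) hτ (neg_ne_zero.2 (sub_ne_zero.2 hy)) (y, -y)
    rw [abs_neg] at this
    refine (le_of_eq ?_).trans this
    have e : ∀ a b, shearFst (a, b) = (a + b, -b) := fun _ _ => rfl
    congr 2; ext x
    simp only [diffKernel, mulDiff, Prod.smul_mk, Prod.mk_add_mk, smul_eq_mul, Function.comp_apply,
      e]
    ring_nf
  · rw [eLpNorm_comp_neg hg]; ring

/-- The shear (x, y) ↦ (-y, x + y) puts g in the place of h. It sends (1,0) to (0,1) and (1,-1) to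
(1,0), so the integration now runs along the y-axis. -/
theorem hasBound_second {p r : ℝ} (hp : 2 < p) (hr : 2 < r) (hpr : 1 / p + 1 / r = 3 / 4) :
    ∃ C : ℝ, 0 < C ∧ ∀ (σ : ℝ × ℝ → ℂ), BddKernel σ → ∀ M N δ : ℝ, 0 < M → 0 < N → 0 < δ →
      HasDecay σ (0, 1) (1, 0) (-1, 1) M N δ → HasBound σ (C * (M / N) ^ (1 / 4 : ℝ)) p 2 r := by
  obtain ⟨C, hC, H⟩ := trilinear_edge_of_decay hr hp (by rw [add_comm]; exact hpr)
  refine ⟨C, hC, fun σ hσ M N δ hM hN hδ hdec f g h hf hfb hg hgb hh hhb => ?_⟩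
  rw [trilinear_comp_shearSnd]
  refine (H _ hσ.comp_shearSnd M N δ hM hN hδ (fun τ hτ y y' hy => ?_) h (fun y => f (-y)) g
    hh hhb (by fun_prop) (hfb.imp fun C hC x => hC _) hg hgb).trans (le_of_eq ?_)
  · refine (le_of_eq ?_).trans (hdec τ (y' - y) hτ (sub_ne_zero.2 hy) (-y, y))
    have e : ∀ a b, shearSnd (a, b) = (-b, a + b) := fun _ _ => rfl
    congr 2; ext x
    simp only [diffKernel, mulDiff, Prod.smul_mk, Prod.mk_add_mk, smul_eq_mul, Function.comp_apply,
      e]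
    ring_nf
  · rw [eLpNorm_comp_neg hf]; ring

end TrilinearOsc

/-! ### Riesz–Thorin interpolation. -/

namespace TrilinearOsc

open MeasureTheory Set
open scoped ENNReal ComplexConjugate

/-- `v ↦ |v|^t sgn v`. -/
noncomputable def powMap (t v : ℂ) : ℂ := (‖v‖ : ℂ) ^ t * (v / ‖v‖)

theorem norm_powMap {t : ℂ} (ht : 0 < t.re) (v : ℂ) : ‖powMap t v‖ = ‖v‖ ^ t.re := by
  rcases eq_or_ne v 0 with rfl | hv
  · simp [powMap, Real.zero_rpow ht.ne']
  · have : 0 < ‖v‖ := norm_pos_iff.2 hv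
    rw [powMap, norm_mul, Complex.norm_cpow_eq_rpow_re_of_pos this, norm_div, Complex.norm_real,
      norm_norm, div_self this.ne', mul_one]

theorem powMap_one (v : ℂ) : powMap 1 v = v := by
  rcases eq_or_ne v 0 with rfl | hv
  · simp [powMap]
  · have : (‖v‖ : ℂ) ≠ 0 := by exact_mod_cast norm_ne_zero_iff.2 hv
    rw [powMap, Complex.cpow_one, mul_div_cancel₀ _ this]

theorem differentiable_powMap {α : ℂ → ℂ} (hα : Differentiable ℂ α) (v : ℂ) :
    Differentiable ℂ (fun z => powMap (α z) v) := by
  rcases eq_or_ne v 0 with rfl | hv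
  · simp [powMap]
  · have : (‖v‖ : ℂ) ≠ 0 := by exact_mod_cast norm_ne_zero_iff.2 hv
    exact (hα.const_cpow (Or.inl this)).mul_const _

theorem norm_powMap_le {t : ℂ} {m : ℝ} (ht : 0 < t.re) (hm : t.re ≤ m) (v : ℂ) :
    ‖powMap t v‖ ≤ (1 + ‖v‖) ^ m := by
  rw [norm_powMap ht]
  have := norm_nonneg v
  exact (Real.rpow_le_rpow (norm_nonneg v) (by linarith) ht.le).trans
    (Real.rpow_le_rpow_of_exponent_le (by linarith) hm)

theorem eLpNorm_of_norm_eq_rpow {F f : ℝ → ℂ} {p s : ℝ} (hp : 0 < p) (hs : 0 < s)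
    (h : ∀ x, ‖F x‖ = ‖f x‖ ^ (p / s)) :
    eLpNorm F (ENNReal.ofReal s) volume = eLpNorm f (ENNReal.ofReal p) volume ^ (p / s) := by
  rw [eLpNorm_eq_lintegral_rpow_enorm_toReal (by simpa using hs) ENNReal.ofReal_ne_top,
    eLpNorm_eq_lintegral_rpow_enorm_toReal (by simpa using hp) ENNReal.ofReal_ne_top,
    ENNReal.toReal_ofReal hp.le, ENNReal.toReal_ofReal hs.le, ← ENNReal.rpow_mul]
  congr 1
  · refine lintegral_congr fun x => ?_
    rw [← ofReal_norm, h, ← ENNReal.ofReal_rpow_of_nonneg (norm_nonneg _) (by positivity),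
      ← ENNReal.rpow_mul, ofReal_norm]
    congr 1; field_simp
  · field_simp

theorem BddKernel.integrable_trilinear {σ : ℝ × ℝ → ℂ} (hσ : BddKernel σ) {f g h : ℝ → ℂ}
    (hf : Measurable f) (hfb : ∃ C, ∀ x, ‖f x‖ ≤ C) (hg : Measurable g) (hgb : ∃ C, ∀ x, ‖g x‖ ≤ C)
    (hh : Measurable h) (hhb : ∃ C, ∀ x, ‖h x‖ ≤ C) :
    Integrable (fun z : ℝ × ℝ => σ z * (f z.1 * g z.2 * h (z.1 + z.2))) := by
  have := ((hσ.mul_bdd (F := fun z => f z.1) (by fun_prop) (hfb.imp fun C h z => h z.1)).mul_bdd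
      (F := fun z => g z.2) (by fun_prop) (hgb.imp fun C h z => h z.2)).mul_bdd
      (F := fun z => h (z.1 + z.2)) (by fun_prop) (hhb.imp fun C h z => h _)
  refine (this.integrable (μ := volume)).congr (Filter.Eventually.of_forall fun z => ?_)
  simp only
  ring

theorem simpleFunc_map_eq_sum (f : SimpleFunc ℝ ℂ) (φ : ℂ → ℂ) (x : ℝ) :
    f.map φ x = ∑ v ∈ f.range, φ v * (f ⁻¹' {v}).indicator 1 x := by
  rw [Finset.sum_eq_single (f x)]
  · simp
  · intro v _ hv
    simp [hv.symm]
  · intro h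
    exact absurd (SimpleFunc.mem_range_self f x) h

theorem bdd_indicator_one (s : Set ℝ) : ∃ C, ∀ x, ‖s.indicator (1 : ℝ → ℂ) x‖ ≤ C :=
  ⟨1, fun x => (norm_indicator_le_norm_self _ _).trans (by simp)⟩

/-- For simple functions the form is a finite sum in which φ and ψ enter only through their values;
an analytic family of such maps therefore gives an analytic function. -/
theorem BddKernel.trilinear_map {σ : ℝ × ℝ → ℂ} (hσ : BddKernel σ) {g : ℝ → ℂ}
    (hg : Measurable g) (hgb : ∃ C, ∀ x, ‖g x‖ ≤ C) (f h : SimpleFunc ℝ ℂ) (φ ψ : ℂ → ℂ) :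
    trilinear σ (f.map φ) g (h.map ψ) = ∑ v ∈ f.range, ∑ w ∈ h.range, φ v * ψ w *
      trilinear σ ((f ⁻¹' {v}).indicator 1) g ((h ⁻¹' {w}).indicator 1) := by
  have hi : ∀ v w, Integrable (fun z : ℝ × ℝ => φ v * ψ w * (σ z *
      ((f ⁻¹' {v}).indicator 1 z.1 * g z.2 * (h ⁻¹' {w}).indicator 1 (z.1 + z.2)))) := fun v w =>
    (hσ.integrable_trilinear (measurable_one.indicator (f.measurableSet_fiber v))
      (bdd_indicator_one _) hg hgb (measurable_one.indicator (h.measurableSet_fiber w))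
      (bdd_indicator_one _)).const_mul _
  unfold trilinear
  simp only [← integral_const_mul]
  have : ∀ v ∈ f.range, ∑ w ∈ h.range, ∫ z : ℝ × ℝ, φ v * ψ w * (σ z *
      ((f ⁻¹' {v}).indicator 1 z.1 * g z.2 * (h ⁻¹' {w}).indicator 1 (z.1 + z.2))) =
      ∫ z : ℝ × ℝ, ∑ w ∈ h.range, φ v * ψ w * (σ z *
      ((f ⁻¹' {v}).indicator 1 z.1 * g z.2 * (h ⁻¹' {w}).indicator 1 (z.1 + z.2))) := fun v _ =>
    (integral_finsetSum _ fun w _ => hi v w).symm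
  rw [Finset.sum_congr rfl this,
    ← integral_finsetSum _ fun v _ => integrable_finsetSum _ fun w _ => hi v w]
  refine integral_congr_ae (Filter.Eventually.of_forall fun z => ?_)
  simp only [simpleFunc_map_eq_sum]
  rw [Finset.sum_mul, Finset.sum_mul_sum, Finset.mul_sum]
  refine Finset.sum_congr rfl fun v _ => ?_
  rw [Finset.mul_sum]
  refine Finset.sum_congr rfl fun w _ => ?_
  ring

/-- Riesz–Thorin interpolation in the first and third arguments. -/
theorem HasBound.interpolate {σ : ℝ × ℝ → ℂ} (hσ : BddKernel σ) {K p₀ p₁ q r₀ r₁ p r θ : ℝ}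
    (hK : 0 < K) (hp₀ : 0 < p₀) (hp₁ : 0 < p₁) (hr₀ : 0 < r₀) (hr₁ : 0 < r₁) (hp : 0 < p)
    (hr : 0 < r) (hθ : θ ∈ Icc (0 : ℝ) 1) (hpθ : 1 / p = (1 - θ) / p₀ + θ / p₁)
    (hrθ : 1 / r = (1 - θ) / r₀ + θ / r₁) (h0 : HasBound σ K p₀ q r₀) (h1 : HasBound σ K p₁ q r₁)
    {g : ℝ → ℂ} (hg : Measurable g) (hgb : ∃ C, ∀ x, ‖g x‖ ≤ C)
    (hgq : eLpNorm g (ENNReal.ofReal q) volume ≠ ∞) (f h : SimpleFunc ℝ ℂ)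
    (hf : eLpNorm f (ENNReal.ofReal p) volume ≠ ∞) (hh : eLpNorm h (ENNReal.ofReal r) volume ≠ ∞) :
    ‖trilinear σ f g h‖ₑ ≤ ENNReal.ofReal K * eLpNorm f (ENNReal.ofReal p) volume *
      eLpNorm g (ENNReal.ofReal q) volume * eLpNorm h (ENNReal.ofReal r) volume := by
  -- A function of zero norm vanishes almost everywhere, so an endpoint bound already gives zero.
  -- Below, both norms may be taken positive.
  have hzero : eLpNorm f (ENNReal.ofReal p) volume = 0 ∨ eLpNorm h (ENNReal.ofReal r) volume = 0 →
      trilinear σ f g h = 0 := by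
    have key : ∀ (u : SimpleFunc ℝ ℂ) {s t : ℝ}, 0 < s →
        eLpNorm u (ENNReal.ofReal s) volume = 0 → eLpNorm u (ENNReal.ofReal t) volume = 0 :=
      fun u s t hs hu => by
        rw [eLpNorm_eq_zero_iff u.measurable.aestronglyMeasurable (by simpa using hs)] at hu
        exact (eLpNorm_congr_ae hu).trans eLpNorm_zero
    have hb := h0 f g h f.measurable f.exists_forall_norm_le hg hgb h.measurable
      h.exists_forall_norm_le
    rintro (hz | hz)
    · rw [key f hp hz] at hb
      simpa using hb
    · rw [key h hr hz] at hb
      simpa using hb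
  rcases eq_or_ne (eLpNorm f (ENNReal.ofReal p) volume) 0 with hf0 | hf0
  · rw [hzero (Or.inl hf0)]; simp
  rcases eq_or_ne (eLpNorm h (ENNReal.ofReal r) volume) 0 with hh0 | hh0
  · rw [hzero (Or.inr hh0)]; simp
  set nf := (eLpNorm f (ENNReal.ofReal p) volume).toReal with hnf
  set nh := (eLpNorm h (ENNReal.ofReal r) volume).toReal with hnh
  set ng := (eLpNorm g (ENNReal.ofReal q) volume).toReal with hng
  have hnf0 : 0 < nf := ENNReal.toReal_pos hf0 hf
  have hnh0 : 0 < nh := ENNReal.toReal_pos hh0 hh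
  have hng0 : 0 ≤ ng := ENNReal.toReal_nonneg
  have hfe : eLpNorm f (ENNReal.ofReal p) volume = ENNReal.ofReal nf := (ENNReal.ofReal_toReal hf).symm
  have hhe : eLpNorm h (ENNReal.ofReal r) volume = ENNReal.ofReal nh := (ENNReal.ofReal_toReal hh).symm
  have hge : eLpNorm g (ENNReal.ofReal q) volume = ENNReal.ofReal ng := (ENNReal.ofReal_toReal hgq).symm
  -- The real part of α is p/p₀ on Re z = 0 and p/p₁ on Re z = 1, and α(θ) = 1; likewise for γ. Thus
  -- |f|^{Re α} has the right endpoint norm on each side, and the family passes through (f, h) at θ.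
  set α : ℂ → ℂ := fun z => p * ((1 - z) / p₀ + z / p₁) with hα
  set γ : ℂ → ℂ := fun z => r * ((1 - z) / r₀ + z / r₁) with hγ
  have re_eq : ∀ (a a₀ a₁ : ℝ) (z : ℂ), ((a : ℂ) * ((1 - z) / a₀ + z / a₁)).re =
      a * ((1 - z.re) / a₀ + z.re / a₁) := fun a a₀ a₁ z => by
    rw [Complex.re_ofReal_mul, Complex.add_re, Complex.div_ofReal_re, Complex.div_ofReal_re]
    simp
  have re_pos : ∀ {a a₀ a₁ x : ℝ}, 0 < a → 0 < a₀ → 0 < a₁ → x ∈ Icc (0 : ℝ) 1 →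
      0 < a * ((1 - x) / a₀ + x / a₁) := fun {a a₀ a₁ x} ha ha₀ ha₁ hx => by
    refine mul_pos ha ?_
    rcases hx.1.eq_or_lt with h | h
    · rw [← h]; simpa using ha₀
    · have : 0 < x / a₁ := by positivity
      have : 0 ≤ (1 - x) / a₀ := div_nonneg (by linarith [hx.2]) ha₀.le
      linarith
  have re_le : ∀ {a a₀ a₁ x : ℝ}, 0 < a → 0 < a₀ → 0 < a₁ → x ∈ Icc (0 : ℝ) 1 →
      a * ((1 - x) / a₀ + x / a₁) ≤ a * (1 / a₀ + 1 / a₁) := fun {a a₀ a₁ x} ha ha₀ ha₁ hx => by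
    have := hx.1
    have := hx.2
    gcongr
    linarith
  have hdα : Differentiable ℂ α := by simp only [hα]; fun_prop
  have hdγ : Differentiable ℂ γ := by simp only [hγ]; fun_prop
  set F : ℂ → ℂ := fun z => trilinear σ (f.map (powMap (α z))) g (h.map (powMap (γ z))) with hF
  have hFsum : F = fun z => ∑ v ∈ f.range, ∑ w ∈ h.range, powMap (α z) v * powMap (γ z) w *
      trilinear σ ((f ⁻¹' {v}).indicator 1) g ((h ⁻¹' {w}).indicator 1) := by
    ext z; exact hσ.trilinear_map hg hgb f h _ _
  have hFd : Differentiable ℂ F := by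
    rw [hFsum]
    exact Differentiable.fun_sum fun v _ => Differentiable.fun_sum fun w _ =>
      ((differentiable_powMap hdα v).mul (differentiable_powMap hdγ w)).mul_const _
  have hFb : BddAbove ((norm ∘ F) '' Complex.HadamardThreeLines.verticalClosedStrip 0 1) := by
    refine ⟨∑ v ∈ f.range, ∑ w ∈ h.range, (1 + ‖v‖) ^ (p * (1 / p₀ + 1 / p₁)) *
      (1 + ‖w‖) ^ (r * (1 / r₀ + 1 / r₁)) *
      ‖trilinear σ ((f ⁻¹' {v}).indicator 1) g ((h ⁻¹' {w}).indicator 1)‖, ?_⟩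
    rintro _ ⟨z, hz, rfl⟩
    have hz' : z.re ∈ Icc (0 : ℝ) 1 := hz
    simp only [Function.comp_apply, hFsum]
    refine (norm_sum_le _ _).trans (Finset.sum_le_sum fun v _ => (norm_sum_le _ _).trans
      (Finset.sum_le_sum fun w _ => ?_))
    rw [norm_mul, norm_mul]
    have b1 := norm_powMap_le (t := α z) (m := p * (1 / p₀ + 1 / p₁))
      (by rw [hα, re_eq]; exact re_pos hp hp₀ hp₁ hz')
      (by rw [hα, re_eq]; exact re_le hp hp₀ hp₁ hz') v
    have b2 := norm_powMap_le (t := γ z) (m := r * (1 / r₀ + 1 / r₁))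
      (by rw [hγ, re_eq]; exact re_pos hr hr₀ hr₁ hz')
      (by rw [hγ, re_eq]; exact re_le hr hr₀ hr₁ hz') w
    gcongr
  have side : ∀ {s t : ℝ} {z : ℂ}, 0 < s → 0 < t → HasBound σ K s q t → (α z).re = p / s →
      (γ z).re = r / t → ‖F z‖ ≤ K * nf ^ (p / s) * ng * nh ^ (r / t) := by
    intro s t z hs ht hb hαz hγz
    have := hb (f.map (powMap (α z))) g (h.map (powMap (γ z))) (SimpleFunc.measurable _)
      (SimpleFunc.exists_forall_norm_le _) hg hgb (SimpleFunc.measurable _)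
      (SimpleFunc.exists_forall_norm_le _)
    rw [eLpNorm_of_norm_eq_rpow (f := f) hp hs (fun x => by
        rw [SimpleFunc.map_apply, norm_powMap (by rw [hαz]; positivity), hαz]),
      eLpNorm_of_norm_eq_rpow (f := h) hr ht (fun x => by
        rw [SimpleFunc.map_apply, norm_powMap (by rw [hγz]; positivity), hγz]), hfe, hhe, hge,
      ENNReal.ofReal_rpow_of_pos hnf0, ENNReal.ofReal_rpow_of_pos hnh0,
      ← ENNReal.ofReal_mul hK.le, ← ENNReal.ofReal_mul (by positivity),
      ← ENNReal.ofReal_mul (by positivity), ← ofReal_norm,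
      ENNReal.ofReal_le_ofReal_iff (by positivity)] at this
    exact this
  have main := Complex.HadamardThreeLines.norm_le_interp_of_mem_verticalClosedStrip'
    (f := F) (z := (θ : ℂ)) (l := 0) (u := 1) zero_lt_one
    (by simpa [Complex.HadamardThreeLines.verticalClosedStrip] using hθ)
    hFd.diffContOnCl hFb
    (fun z hz => side hp₀ hr₀ h0
      (by rw [hα, re_eq, show z.re = 0 from hz]; ring)
      (by rw [hγ, re_eq, show z.re = 0 from hz]; ring))
    (fun z hz => side hp₁ hr₁ h1
      (by rw [hα, re_eq, show z.re = 1 from hz]; ring)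
      (by rw [hγ, re_eq, show z.re = 1 from hz]; ring))
  have hα1 : α θ = 1 := by
    have : p * ((1 - θ) / p₀ + θ / p₁) = 1 := by rw [← hpθ]; field_simp
    simp only [hα]; exact_mod_cast this
  have hγ1 : γ θ = 1 := by
    have : r * ((1 - θ) / r₀ + θ / r₁) = 1 := by rw [← hrθ]; field_simp
    simp only [hγ]; exact_mod_cast this
  have hFθ : F θ = trilinear σ f g h := by
    simp only [hF, hα1, hγ1]
    congr 1 <;> (ext x; simp [powMap_one])
  rw [hFθ] at main
  rw [hfe, hhe, hge, ← ENNReal.ofReal_mul hK.le, ← ENNReal.ofReal_mul (by positivity),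
      ← ENNReal.ofReal_mul (by positivity), ← ofReal_norm]
  refine ENNReal.ofReal_le_ofReal (main.trans (le_of_eq ?_))
  simp only [Complex.ofReal_re, sub_zero, div_one]
  have pw : ∀ {x : ℝ} (_ : 0 < x) (a a₀ a₁ : ℝ), a * ((1 - θ) / a₀ + θ / a₁) = 1 →
      (x ^ (a / a₀)) ^ (1 - θ) * (x ^ (a / a₁)) ^ θ = x := fun {x} hx a a₀ a₁ h => by
    rw [← Real.rpow_mul hx.le, ← Real.rpow_mul hx.le, ← Real.rpow_add hx,
      show a / a₀ * (1 - θ) + a / a₁ * θ = a * ((1 - θ) / a₀ + θ / a₁) by ring, h, Real.rpow_one]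
  have p1 : ∀ {x : ℝ} (_ : 0 ≤ x), x ^ (1 - θ) * x ^ θ = x := fun {x} hx => by
    rw [← Real.rpow_add' hx (by simp), sub_add_cancel, Real.rpow_one]
  have ef := pw hnf0 p p₀ p₁ (by rw [← hpθ]; field_simp)
  have eh := pw hnh0 r r₀ r₁ (by rw [← hrθ]; field_simp)
  have eK := p1 hK.le
  have eg := p1 hng0
  have hx : ∀ (s t : ℝ) (x : ℝ), (K * nf ^ s * ng * nh ^ t) ^ x =
      K ^ x * (nf ^ s) ^ x * ng ^ x * (nh ^ t) ^ x := fun s t x => by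
    rw [Real.mul_rpow (by positivity) (by positivity), Real.mul_rpow (by positivity) hng0,
      Real.mul_rpow hK.le (by positivity)]
  rw [hx, hx]
  calc _ = (K ^ (1 - θ) * K ^ θ) * ((nf ^ (p / p₀)) ^ (1 - θ) * (nf ^ (p / p₁)) ^ θ) *
        (ng ^ (1 - θ) * ng ^ θ) * ((nh ^ (r / r₀)) ^ (1 - θ) * (nh ^ (r / r₁)) ^ θ) := by ring
    _ = _ := by rw [ef, eh, eK, eg]

end TrilinearOsc

/-! ### Density of simple functions and the full range of exponents. -/

namespace TrilinearOsc

open MeasureTheory Set Filter Topology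
open scoped ENNReal ComplexConjugate

theorem integrable_sq_indicator {f : ℝ → ℂ} {p : ℝ≥0∞} (hp : 2 ≤ p) (hf : MemLp f p volume)
    (R : ℝ) : Integrable (fun x => ‖(Icc (-R) R).indicator f x‖ ^ 2) := by
  have h1 : MemLp f p (volume.restrict (Icc (-R) R)) := hf.restrict _
  have h2 : MemLp f 2 (volume.restrict (Icc (-R) R)) := h1.mono_exponent hp
  have h3 : MemLp ((Icc (-R) R).indicator f) 2 volume :=
    (memLp_indicator_iff_restrict measurableSet_Icc).2 h2
  exact h3.integrable_norm_pow two_ne_zero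

/-- On the bounded support |fgh| ≤ |f|²|g|² + |h|². Exponents at least 2 make all three functions
locally square integrable; a shear handles h(x + y). -/
theorem BddKernel.integrable_of_memLp {σ : ℝ × ℝ → ℂ} (hσ : BddKernel σ) {f g h : ℝ → ℂ}
    {p q r : ℝ≥0∞} (hp : 2 ≤ p) (hq : 2 ≤ q) (hr : 2 ≤ r) (hfm : Measurable f) (hgm : Measurable g)
    (hhm : Measurable h) (hf : MemLp f p volume) (hg : MemLp g q volume) (hh : MemLp h r volume) :
    Integrable (fun z : ℝ × ℝ => σ z * (f z.1 * g z.2 * h (z.1 + z.2))) := by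
  obtain ⟨hm, ⟨C, hC⟩, R, hR⟩ := hσ
  have hC0 : 0 ≤ C := (norm_nonneg _).trans (hC 0)
  have i1 : Integrable (fun z : ℝ × ℝ => ‖(Icc (-R) R).indicator f z.1‖ ^ 2 *
      ‖(Icc (-R) R).indicator g z.2‖ ^ 2) volume :=
    (integrable_sq_indicator hp hf R).mul_prod (integrable_sq_indicator hq hg R)
  have i2 : Integrable (fun z : ℝ × ℝ => (Icc (-R) R).indicator (1 : ℝ → ℝ) z.1 *
      ‖(Icc (-(2 * R)) (2 * R)).indicator h (z.1 + z.2)‖ ^ 2) volume := by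
    have h1 : Integrable ((Icc (-R) R).indicator (1 : ℝ → ℝ)) volume :=
      (integrable_indicator_iff measurableSet_Icc).2 (integrableOn_const (by simp))
    have h2 := h1.mul_prod (integrable_sq_indicator hr hh (2 * R))
    exact ((measurePreserving_prod_add (volume : Measure ℝ) volume).integrable_comp h2.1).2 h2
  refine ((i1.add i2).const_mul C).mono' (by fun_prop) (Eventually.of_forall fun z => ?_)
  by_cases hz : R < ‖z‖
  · rw [hR z hz, zero_mul, norm_zero]
    refine mul_nonneg hC0 (add_nonneg (by positivity) (mul_nonneg ?_ (by positivity)))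
    exact indicator_nonneg (fun _ _ => zero_le_one) _
  · have hz' : ‖z‖ ≤ R := not_lt.1 hz
    rw [Prod.norm_def, max_le_iff, Real.norm_eq_abs, Real.norm_eq_abs] at hz'
    have m1 : z.1 ∈ Icc (-R) R := abs_le.1 hz'.1
    have m2 : z.2 ∈ Icc (-R) R := abs_le.1 hz'.2
    have m3 : z.1 + z.2 ∈ Icc (-(2 * R)) (2 * R) :=
      ⟨by linarith [m1.1, m2.1], by linarith [m1.2, m2.2]⟩
    simp only [Pi.add_apply, indicator_of_mem m1, indicator_of_mem m2, indicator_of_mem m3,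
      Pi.one_apply, one_mul, norm_mul]
    refine mul_le_mul (hC z) ?_ (by positivity) hC0
    nlinarith [sq_nonneg (‖f z.1‖ * ‖g z.2‖ - ‖h (z.1 + z.2)‖), sq_nonneg (‖f z.1‖ * ‖g z.2‖),
      sq_nonneg ‖h (z.1 + z.2)‖]

theorem exists_simpleFunc_approx {f : ℝ → ℂ} (hfm : Measurable f) {p : ℝ≥0∞} (hp1 : 1 ≤ p)
    (hp : p ≠ ∞) (hf : MemLp f p volume) :
    ∃ u : ℕ → SimpleFunc ℝ ℂ, (∀ n x, ‖u n x‖ ≤ 2 * ‖f x‖) ∧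
      (∀ x, Tendsto (fun n => u n x) atTop (𝓝 (f x))) ∧ (∀ n, eLpNorm (u n) p volume ≠ ∞) ∧
      ∃ ν : ℕ → ℝ≥0∞, Tendsto ν atTop (𝓝 (eLpNorm f p volume)) ∧
        ∀ n, eLpNorm (u n) p volume ≤ ν n := by
  have hu := fun n => SimpleFunc.memLp_approxOn (E := ℂ) (s := univ) (y₀ := 0) hfm hf (mem_univ _)
    MemLp.zero n
  refine ⟨fun n => SimpleFunc.approxOn f hfm univ 0 (mem_univ _) n, fun n x => ?_, fun x => ?_,
    fun n => (hu n).2.ne, fun n => eLpNorm f p volume +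
      eLpNorm (⇑(SimpleFunc.approxOn f hfm univ 0 (mem_univ _) n) - f) p volume, ?_, fun n => ?_⟩
  · rw [two_mul]; exact SimpleFunc.norm_approxOn_zero_le hfm (mem_univ _) x n
  · exact SimpleFunc.tendsto_approxOn hfm (mem_univ _) (by simp)
  · have := SimpleFunc.tendsto_approxOn_Lp_eLpNorm hfm (s := univ) (y₀ := 0) (mem_univ _) hp
      (μ := volume) (by simp) (by simpa using hf.2)
    simpa using tendsto_const_nhds.add this
  · refine le_trans (le_of_eq ?_) (eLpNorm_add_le hf.1 ((hu n).1.sub hf.1) hp1)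
    congr 1
    abel

theorem BddKernel.bound_of_simpleFunc {σ : ℝ × ℝ → ℂ} (hσ : BddKernel σ) {K : ℝ} {p q r : ℝ≥0∞}
    (hp : 2 ≤ p) (hq : 2 ≤ q) (hr : 2 ≤ r) (hp' : p ≠ ∞) (hq' : q ≠ ∞) (hr' : r ≠ ∞)
    (H : ∀ f g h : SimpleFunc ℝ ℂ, eLpNorm f p volume ≠ ∞ → eLpNorm g q volume ≠ ∞ →
      eLpNorm h r volume ≠ ∞ → ‖trilinear σ f g h‖ₑ ≤ ENNReal.ofReal K * eLpNorm f p volume *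
      eLpNorm g q volume * eLpNorm h r volume) {f g h : ℝ → ℂ} (hfm : Measurable f)
    (hgm : Measurable g) (hhm : Measurable h) (hf : MemLp f p volume) (hg : MemLp g q volume)
    (hh : MemLp h r volume) :
    ‖trilinear σ f g h‖ₑ ≤ ENNReal.ofReal K * eLpNorm f p volume *
      eLpNorm g q volume * eLpNorm h r volume := by
  obtain ⟨u, u1, u2, u3, νu, u4, u5⟩ :=
    exists_simpleFunc_approx hfm (one_le_two.trans hp) hp' hf
  obtain ⟨v, v1, v2, v3, νv, v4, v5⟩ :=
    exists_simpleFunc_approx hgm (one_le_two.trans hq) hq' hg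
  obtain ⟨w, w1, w2, w3, νw, w4, w5⟩ :=
    exists_simpleFunc_approx hhm (one_le_two.trans hr) hr' hh
  have hm := hσ.1
  have hi := hσ.integrable_of_memLp hp hq hr hfm hgm hhm hf hg hh
  have lim : Tendsto (fun n => trilinear σ (u n) (v n) (w n)) atTop (𝓝 (trilinear σ f g h)) := by
    -- Each approximant is at most twice its limit in norm, hence the factor 8 in the dominating
    -- function.
    refine tendsto_integral_of_dominated_convergence
      (fun z => 8 * ‖σ z * (f z.1 * g z.2 * h (z.1 + z.2))‖) (fun n => ?_) (hi.norm.const_mul 8)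
      (fun n => Eventually.of_forall fun z => ?_) (Eventually.of_forall fun z => ?_)
    · have := (u n).measurable
      have := (v n).measurable
      have := (w n).measurable
      fun_prop
    · simp only [norm_mul]
      calc _ ≤ ‖σ z‖ * ((2 * ‖f z.1‖) * (2 * ‖g z.2‖) * (2 * ‖h (z.1 + z.2)‖)) := by
            gcongr
            · exact u1 _ _
            · exact v1 _ _
            · exact w1 _ _
        _ = _ := by ring
    · exact (((u2 _).mul (v2 _)).mul (w2 _)).const_mul _
  have nf := hf.2.ne
  have ng := hg.2.ne
  have nh := hh.2.ne
  have lim2 : Tendsto (fun n => ENNReal.ofReal K * νu n * νv n * νw n) atTop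
      (𝓝 (ENNReal.ofReal K * eLpNorm f p volume * eLpNorm g q volume * eLpNorm h r volume)) := by
    have a1 := ENNReal.Tendsto.const_mul (a := ENNReal.ofReal K) u4 (Or.inr ENNReal.ofReal_ne_top)
    have b1 := ENNReal.mul_ne_top (ENNReal.ofReal_ne_top (r := K)) nf
    have a2 := ENNReal.Tendsto.mul a1 (Or.inr ng) v4 (Or.inr b1)
    exact ENNReal.Tendsto.mul a2 (Or.inr nh) w4 (Or.inr (ENNReal.mul_ne_top b1 ng))
  refine le_of_tendsto_of_tendsto' lim.enorm lim2 fun n => ?_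
  refine (H (u n) (v n) (w n) (u3 n) (v3 n) (w3 n)).trans ?_
  gcongr
  · exact u5 n
  · exact v5 n
  · exact w5 n

theorem HasBound.mono {σ : ℝ × ℝ → ℂ} {K K' p q r : ℝ} (h : HasBound σ K p q r) (hK : K ≤ K') :
    HasBound σ K' p q r := fun f g k hf hfb hg hgb hk hkb =>
  (h f g k hf hfb hg hgb hk hkb).trans (by gcongr)

theorem exists_bound_simpleFunc {p q r : ℝ} (hpqr : (p, q, r) ∈ exponents) :
    ∃ C : ℝ, 0 < C ∧ ∀ (σ : ℝ × ℝ → ℂ), BddKernel σ → ∀ M N δ₁ δ₂ : ℝ, 0 < M → 0 < N →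
      0 < δ₁ → 0 < δ₂ → HasDecay σ (1, 0) (-1, 1) (0, 1) M N δ₁ →
      HasDecay σ (1, 0) (0, 1) (-1, 1) M N δ₁ → HasDecay σ (0, 1) (1, 0) (-1, 1) M N δ₂ →
      ∀ f g h : SimpleFunc ℝ ℂ, eLpNorm f (ENNReal.ofReal p) volume ≠ ∞ →
      eLpNorm g (ENNReal.ofReal q) volume ≠ ∞ → eLpNorm h (ENNReal.ofReal r) volume ≠ ∞ →
      ‖trilinear σ f g h‖ₑ ≤ ENNReal.ofReal (C * (M / N) ^ (1 / 4 : ℝ)) *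
        eLpNorm f (ENNReal.ofReal p) volume * eLpNorm g (ENNReal.ofReal q) volume *
        eLpNorm h (ENNReal.ofReal r) volume := by
  obtain ⟨⟨hp, hp4⟩, ⟨hq, hq4⟩, ⟨hr, hr4⟩, hsum⟩ := hpqr
  simp only at hp hp4 hq hq4 hr hr4 hsum
  have inv_gt : ∀ {x : ℝ}, 2 ≤ x → x < 4 → 1 / 4 < 1 / x := fun {x} hx hx4 =>
    one_div_lt_one_div_of_lt (by linarith) hx4
  have p4 := inv_gt hp hp4
  have q4 := inv_gt hq hq4
  have r4 := inv_gt hr hr4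
  have gt_two : ∀ {x : ℝ}, 2 ≤ x → 1 / x < 1 / 2 → 2 < x := fun {x} hx h =>
    (one_div_lt_one_div (by linarith) two_pos).1 h
  rcases hr.eq_or_lt with rfl | hr2
  · obtain ⟨C, hC, H⟩ := hasBound_third (gt_two hp (by linarith)) (gt_two hq (by linarith))
      (by linarith : 1 / p + 1 / q = 3 / 4)
    exact ⟨C, hC, fun σ hσ M N δ₁ δ₂ hM hN hδ₁ hδ₂ d1 d2 d3 f g h _ _ _ =>
      H σ hσ M N δ₁ hM hN hδ₁ d1 f g h f.measurable f.exists_forall_norm_le g.measurable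
        g.exists_forall_norm_le h.measurable h.exists_forall_norm_le⟩
  rcases hp.eq_or_lt with rfl | hp2
  · obtain ⟨C, hC, H⟩ := hasBound_first (gt_two hq (by linarith)) (gt_two hr (by linarith))
      (by linarith : 1 / q + 1 / r = 3 / 4)
    exact ⟨C, hC, fun σ hσ M N δ₁ δ₂ hM hN hδ₁ hδ₂ d1 d2 d3 f g h _ _ _ =>
      H σ hσ M N δ₁ hM hN hδ₁ d2 f g h f.measurable f.exists_forall_norm_le g.measurable
        g.exists_forall_norm_le h.measurable h.exists_forall_norm_le⟩
  rcases hq.eq_or_lt with rfl | hq2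
  · obtain ⟨C, hC, H⟩ := hasBound_second (gt_two hp (by linarith)) (gt_two hr (by linarith))
      (by linarith : 1 / p + 1 / r = 3 / 4)
    exact ⟨C, hC, fun σ hσ M N δ₁ δ₂ hM hN hδ₁ hδ₂ d1 d2 d3 f g h _ _ _ =>
      H σ hσ M N δ₂ hM hN hδ₂ d3 f g h f.measurable f.exists_forall_norm_le g.measurable
        g.exists_forall_norm_le h.measurable h.exists_forall_norm_le⟩
  have lt_half : ∀ {x : ℝ}, 2 < x → 1 / x < 1 / 2 := fun {x} hx =>
    one_div_lt_one_div_of_lt two_pos hx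
  have p2 := lt_half hp2
  have q2 := lt_half hq2
  have r2 := lt_half hr2
  -- With q fixed, (2, q, s) and (s, q, 2) are the points of the edges p = 2 and r = 2; here s > 2
  -- because q < 4.
  set s : ℝ := 1 / (3 / 4 - 1 / q) with hs
  have hs' : 1 / s = 3 / 4 - 1 / q := one_div_one_div _
  have hs0 : 0 < s := one_div_pos.2 (by linarith)
  have hs2 : 2 < s := (one_div_lt_one_div hs0 two_pos).1 (by rw [hs']; linarith)
  obtain ⟨C₁, hC₁, H₁⟩ := hasBound_first hq2 hs2 (by rw [hs']; ring)
  obtain ⟨C₂, hC₂, H₂⟩ := hasBound_third hs2 hq2 (by rw [hs']; ring)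
  refine ⟨C₁ + C₂, by positivity, fun σ hσ M N δ₁ δ₂ hM hN hδ₁ hδ₂ d1 d2 d3 f g h hf hg hh => ?_⟩
  have hMN : 0 < (M / N) ^ (1 / 4 : ℝ) := by positivity
  have b1 : HasBound σ ((C₁ + C₂) * (M / N) ^ (1 / 4 : ℝ)) 2 q s :=
    (H₁ σ hσ M N δ₁ hM hN hδ₁ d2).mono (by gcongr; linarith)
  have b2 : HasBound σ ((C₁ + C₂) * (M / N) ^ (1 / 4 : ℝ)) s q 2 :=
    (H₂ σ hσ M N δ₁ hM hN hδ₁ d1).mono (by gcongr; linarith)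
  have hd : 0 < 1 / q - 1 / 4 := by linarith
  -- This solves 1/p = (1-θ)/2 + θ/s. The sum condition then gives the matching equation for r, and
  -- r ≥ 2 gives θ ≤ 1.
  set θ : ℝ := (1 / 2 - 1 / p) / (1 / q - 1 / 4) with hθ
  have hθe : θ * (1 / q - 1 / 4) = 1 / 2 - 1 / p := div_mul_cancel₀ _ hd.ne'
  refine HasBound.interpolate (θ := θ) hσ (by positivity) two_pos hs0 hs0 two_pos (by linarith)
    (by linarith) ⟨div_nonneg (by linarith) hd.le, (div_le_one hd).2 (by linarith)⟩ ?_ ?_ b1 b2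
    g.measurable g.exists_forall_norm_le hg f h hf hh
  · rw [div_eq_mul_one_div θ s, hs']; linarith
  · rw [div_eq_mul_one_div (1 - θ) s, hs']; linarith

end TrilinearOsc

/-! ### The oscillatory kernel and the conclusion. -/

namespace TrilinearOsc

open MeasureTheory Set Filter Topology
open scoped ENNReal ComplexConjugate ContDiff

/-- Only linearity of the derivative in its direction is used, so no smoothness is needed. D is
thus, up to sign, the product of the derivatives along the three directions of the hull. -/
theorem D_eq_neg (S : ℝ × ℝ → ℝ) :
    D S = fun z => -pd (1, 0) (pd (0, 1) (pd (-1, 1) S)) z := by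
  have : pd (-1, 1) S = fun z => -(dx S z - dy S z) := by
    ext z
    simp only [pd, dx, dy]
    rw [show ((-1, 1) : ℝ × ℝ) = (0, 1) - (1, 0) by simp, map_sub]
    ring
  rw [this, pd_neg, pd_neg]
  ext z
  rw [neg_neg]
  rfl

theorem subset_dirConvexHull (V X : Set (ℝ × ℝ)) : X ⊆ dirConvexHull V X :=
  subset_sInter fun _ hY => hY.1

theorem dirConvex_dirConvexHull {V : Set (ℝ × ℝ)} (X : Set (ℝ × ℝ)) {v : ℝ × ℝ} (hv : v ∈ V) :
    DirConvex v (dirConvexHull V X) := fun a ha b hb hab =>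
  subset_sInter fun Y hY => hY.2 v hv a (ha Y hY) b (hb Y hY) hab

theorem continuous_oscKernel {lam : ℝ} {S : ℝ × ℝ → ℝ} {φ : ℝ × ℝ → ℂ} {U : Set (ℝ × ℝ)}
    (hU : IsOpen U) (hS : ContinuousOn S U) (hφ : Continuous φ) (hφU : tsupport φ ⊆ U) :
    Continuous (oscKernel lam S φ) := by
  rw [continuous_iff_continuousAt]
  intro z
  by_cases hz : z ∈ tsupport φ
  · have hSz : ContinuousAt S z := hS.continuousAt (hU.mem_nhds (hφU hz))
    have hφz : ContinuousAt φ z := hφ.continuousAt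
    unfold oscKernel
    fun_prop
  · refine (continuousAt_const (y := (0 : ℂ))).congr ?_
    filter_upwards [(isClosed_tsupport φ).isOpen_compl.mem_nhds hz] with y hy
    simp [oscKernel, image_eq_zero_of_notMem_tsupport hy]

theorem norm_oscKernel (lam : ℝ) (S : ℝ × ℝ → ℝ) (φ : ℝ × ℝ → ℂ) (z : ℝ × ℝ) :
    ‖oscKernel lam S φ z‖ = ‖φ z‖ := by
  rw [oscKernel, norm_mul, mul_comm Complex.I, Complex.norm_exp_ofReal_mul_I, one_mul]

theorem bddKernel_oscKernel {lam : ℝ} {S : ℝ × ℝ → ℝ} {φ : ℝ × ℝ → ℂ} {U : Set (ℝ × ℝ)}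
    (hU : IsOpen U) (hS : ContinuousOn S U) (hφ : Continuous φ) (hφU : tsupport φ ⊆ U)
    (hφc : HasCompactSupport φ) : BddKernel (oscKernel lam S φ) := by
  obtain ⟨C, hC⟩ := hφc.exists_bound_of_continuous hφ
  obtain ⟨R, hR⟩ := hφc.isCompact.isBounded.exists_norm_le
  refine ⟨(continuous_oscKernel hU hS hφ hφU).measurable, ⟨C, fun z => ?_⟩, R, fun z hz => ?_⟩
  · rw [norm_oscKernel]; exact hC z
  · rw [oscKernel, image_eq_zero_of_notMem_tsupport fun h => hz.not_ge (hR z h), mul_zero]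

/-- The decay of the kernel `e^{iλS} φ` along a direction `e`, in terms of `D S`. -/
theorem exists_hasDecay {A B c : ℝ} (hA : 0 < A) (hB : 0 < B) (hc : 0 < c) :
    ∃ M : ℝ, 0 < M ∧ ∀ (δ μ : ℝ), 0 < δ → 0 < μ → ∀ (φ : ℝ × ℝ → ℂ), ContDiff ℝ ∞ φ →
      ∀ e v w : ℝ × ℝ,
      (∀ (z : ℝ × ℝ) (x x' : ℝ), z + x • e ∈ tsupport φ → z + x' • e ∈ tsupport φ →
        |x - x'| ≤ δ) →
      (∀ z, ‖pd e φ z‖ ≤ A / δ) → (∀ z, ‖pd e (pd e φ) z‖ ≤ A / δ ^ 2) →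
      ∀ (U C : Set (ℝ × ℝ)) (S : ℝ × ℝ → ℝ), IsOpen U → ContDiffOn ℝ ∞ S U →
      tsupport φ ⊆ C → C ⊆ U → DirConvex v C → DirConvex w C →
      EqOn (pd v (pd w (pd e S))) (fun z => -D S z) U →
      (∀ z ∈ C, c * μ ≤ |D S z|) → (∀ z ∈ C, |pd e (D S) z| ≤ B * (μ / δ)) →
      (∀ z ∈ C, |pd e (pd e (D S)) z| ≤ B * (μ / δ ^ 2)) →
      ∀ lam : ℝ, lam ≠ 0 → HasDecay (oscKernel lam S φ) e v w M (|lam| * μ) δ := by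
  obtain ⟨M, hM, H⟩ := mulDiff_integral_le hA hB hc
  refine ⟨M, hM, ?_⟩
  intro δ μ hδ hμ φ hφ e v w hw hφ1 hφ2 U C S hU hS hTC hCU hv hwC hD h0 h1 h2 lam hlam a b ha hb z
  have hD1 : EqOn (pd e (pd v (pd w (pd e S)))) (fun z => -pd e (D S) z) U := fun z hz => by
    rw [pd_congr hU hD e hz, pd_neg]
  have hD2 : EqOn (pd e (pd e (pd v (pd w (pd e S))))) (fun z => -pd e (pd e (D S)) z) U :=
    fun z hz => by rw [pd_congr hU hD1 e hz, pd_neg]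
  refine H δ μ hδ hμ φ hφ e v w hw hφ1 hφ2 U C S hU hS hTC hCU hv hwC (fun z hz => ?_)
    (fun z hz => ?_) (fun z hz => ?_) lam hlam a b ha hb z
  · rw [hD (hCU hz), abs_neg]; exact h0 z hz
  · rw [hD1 (hCU hz), abs_neg]; exact h1 z hz
  · rw [hD2 (hCU hz), abs_neg]; exact h2 z hz

/-- Passes to measurable representatives. The map (x, y) ↦ x + y pulls null sets back to null sets,
so changing h on a null set is harmless. -/
theorem BddKernel.integrable_and_bound {σ : ℝ × ℝ → ℂ} (hσ : BddKernel σ) {K : ℝ} (hK : 0 < K)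
    {p q r : ℝ≥0∞} (hp : 2 ≤ p) (hq : 2 ≤ q) (hr : 2 ≤ r) (hp' : p ≠ ⊤) (hq' : q ≠ ⊤) (hr' : r ≠ ⊤)
    (H : ∀ f g h : SimpleFunc ℝ ℂ, eLpNorm f p volume ≠ ⊤ → eLpNorm g q volume ≠ ⊤ →
      eLpNorm h r volume ≠ ⊤ → ‖trilinear σ f g h‖ₑ ≤ ENNReal.ofReal K * eLpNorm f p volume *
      eLpNorm g q volume * eLpNorm h r volume) {f g h : ℝ → ℂ} (hf : MemLp f p volume)
    (hg : MemLp g q volume) (hh : MemLp h r volume) :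
    Integrable (fun z : ℝ × ℝ => σ z * (f z.1 * g z.2 * h (z.1 + z.2))) ∧
      ‖trilinear σ f g h‖ ≤ K * (eLpNorm f p volume).toReal * (eLpNorm g q volume).toReal *
        (eLpNorm h r volume).toReal := by
  have ef := hf.1.ae_eq_mk
  have eg := hg.1.ae_eq_mk
  have eh := hh.1.ae_eq_mk
  have mf := hf.1.stronglyMeasurable_mk.measurable
  have mg := hg.1.stronglyMeasurable_mk.measurable
  have mh := hh.1.stronglyMeasurable_mk.measurable
  have hf' := hf.ae_eq ef
  have hg' := hg.ae_eq eg
  have hh' := hh.ae_eq eh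
  have hsum : Measure.QuasiMeasurePreserving (fun z : ℝ × ℝ => z.1 + z.2) volume volume :=
    (Measure.quasiMeasurePreserving_snd (μ := (volume : Measure ℝ)) (ν := (volume : Measure ℝ))).comp
      (measurePreserving_prod_add (volume : Measure ℝ) volume).quasiMeasurePreserving
  have e : (fun z : ℝ × ℝ => σ z * (hf.1.mk f z.1 * hg.1.mk g z.2 * hh.1.mk h (z.1 + z.2)))
      =ᵐ[volume] fun z => σ z * (f z.1 * g z.2 * h (z.1 + z.2)) := by
    have e1 := (Measure.quasiMeasurePreserving_fst (μ := (volume : Measure ℝ))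
      (ν := (volume : Measure ℝ))).ae_eq_comp ef
    have e2 := (Measure.quasiMeasurePreserving_snd (μ := (volume : Measure ℝ))
      (ν := (volume : Measure ℝ))).ae_eq_comp eg
    rw [← Measure.volume_eq_prod] at e1 e2
    filter_upwards [e1, e2, hsum.ae_eq_comp eh] with z h1 h2 h3
    simp only [Function.comp_apply] at h1 h2 h3
    rw [h1, h2, h3]
  refine ⟨(hσ.integrable_of_memLp hp hq hr mf mg mh hf' hg' hh').congr e, ?_⟩
  have hb := hσ.bound_of_simpleFunc hp hq hr hp' hq' hr' H mf mg mh hf' hg' hh'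
  rw [show trilinear σ (hf.1.mk f) (hg.1.mk g) (hh.1.mk h) = trilinear σ f g h from
    integral_congr_ae e, ← eLpNorm_congr_ae ef, ← eLpNorm_congr_ae eg, ← eLpNorm_congr_ae eh] at hb
  have := ENNReal.toReal_mono (ENNReal.mul_ne_top (ENNReal.mul_ne_top
    (ENNReal.mul_ne_top ENNReal.ofReal_ne_top hf.2.ne) hg.2.ne) hh.2.ne) hb
  simpa only [ENNReal.toReal_mul, ENNReal.toReal_ofReal hK.le, toReal_enorm] using this

end TrilinearOsc

theorem corollary2p4
    -- the implicit constants of the hypotheses, and the exponents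
    (A c B : ℝ) (hA : 0 < A) (hc : 0 < c) (hB : 0 < B)
    (p q r : ℝ) (hpqr : (p, q, r) ∈ TrilinearOsc.exponents) :
    ∃ C : ℝ, 0 < C ∧
      ∀ (δ₁ δ₂ μ : ℝ), 0 < δ₁ → 0 < δ₂ → 0 < μ →
      ∀ (φ : ℝ × ℝ → ℂ), ContDiff ℝ (⊤ : ℕ∞) φ → HasCompactSupport φ →
        TrilinearOsc.HasWidthsLE (tsupport φ) δ₁ δ₂ →
        (∀ l ∈ ({1, 2} : Finset ℕ), ∀ z : ℝ × ℝ,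
          ‖(TrilinearOsc.dx^[l] φ) z‖ ≤ A / δ₁ ^ l ∧
          ‖(TrilinearOsc.dy^[l] φ) z‖ ≤ A / δ₂ ^ l) →
      ∀ (U : Set (ℝ × ℝ)) (S : ℝ × ℝ → ℝ), IsOpen U → ContDiffOn ℝ (⊤ : ℕ∞) S U →
        TrilinearOsc.dirConvexHull TrilinearOsc.directions (tsupport φ) ⊆ U →
        (∀ z ∈ TrilinearOsc.dirConvexHull TrilinearOsc.directions (tsupport φ),
          c * μ ≤ |TrilinearOsc.D S z| ∧
          ∀ l ∈ ({1, 2} : Finset ℕ),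
            |(TrilinearOsc.dx^[l] (TrilinearOsc.D S)) z| ≤ B * (μ / δ₁ ^ l) ∧
            |(TrilinearOsc.dy^[l] (TrilinearOsc.D S)) z| ≤ B * (μ / δ₂ ^ l)) →
      ∀ (lam : ℝ), lam ≠ 0 →
      ∀ (f g h : ℝ → ℂ),
        TrilinearOsc.InLp f p → TrilinearOsc.InLp g q → TrilinearOsc.InLp h r →
        MeasureTheory.Integrable (TrilinearOsc.integrand lam S φ f g h)
          MeasureTheory.volume ∧
        ‖TrilinearOsc.form lam S φ f g h‖ ≤
          C * |lam * μ| ^ (-(1 / 4) : ℝ) *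
            TrilinearOsc.lpNorm f p * TrilinearOsc.lpNorm g q * TrilinearOsc.lpNorm h r := by
  obtain ⟨M, hM, HM⟩ := TrilinearOsc.exists_hasDecay hA hB hc
  obtain ⟨C, hC, HC⟩ := TrilinearOsc.exists_bound_simpleFunc hpqr
  obtain ⟨⟨hp, -⟩, ⟨hq, -⟩, ⟨hr, -⟩, -⟩ := hpqr
  simp only at hp hq hr
  refine ⟨C * M ^ (1 / 4 : ℝ), by positivity, ?_⟩
  intro δ₁ δ₂ μ hδ₁ hδ₂ hμ φ hφ hφc hw hφb U S hU hS hHU hDS lam hlam f g h hf hg hh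
  have hl : 0 < |lam| := abs_pos.2 hlam
  have hTH := TrilinearOsc.subset_dirConvexHull TrilinearOsc.directions (tsupport φ)
  have cu : TrilinearOsc.DirConvex (1, 0) (TrilinearOsc.dirConvexHull TrilinearOsc.directions
      (tsupport φ)) := TrilinearOsc.dirConvex_dirConvexHull _ (by simp [TrilinearOsc.directions])
  have cv : TrilinearOsc.DirConvex (0, 1) (TrilinearOsc.dirConvexHull TrilinearOsc.directions
      (tsupport φ)) := TrilinearOsc.dirConvex_dirConvexHull _ (by simp [TrilinearOsc.directions])
  have cw : TrilinearOsc.DirConvex (-1, 1) (TrilinearOsc.dirConvexHull TrilinearOsc.directions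
      (tsupport φ)) := TrilinearOsc.dirConvex_dirConvexHull _ (by simp [TrilinearOsc.directions])
  have wx : ∀ (z : ℝ × ℝ) (x x' : ℝ), z + x • ((1, 0) : ℝ × ℝ) ∈ tsupport φ →
      z + x' • ((1, 0) : ℝ × ℝ) ∈ tsupport φ → |x - x'| ≤ δ₁ := fun z x x' h h' => by
    simpa using hw.1 (z.1 + x) (z.1 + x') z.2 (by convert h using 1; ext <;> simp)
      (by convert h' using 1; ext <;> simp)
  have wy : ∀ (z : ℝ × ℝ) (x x' : ℝ), z + x • ((0, 1) : ℝ × ℝ) ∈ tsupport φ →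
      z + x' • ((0, 1) : ℝ × ℝ) ∈ tsupport φ → |x - x'| ≤ δ₂ := fun z x x' h h' => by
    simpa using hw.2 z.1 (z.2 + x) (z.2 + x') (by convert h using 1; ext <;> simp)
      (by convert h' using 1; ext <;> simp)
  have φ1 := hφb 1 (by simp)
  have φ2 := hφb 2 (by simp)
  have S1 := fun z hz => (hDS z hz).2 1 (by simp)
  have S2 := fun z hz => (hDS z hz).2 2 (by simp)
  simp only [pow_one] at φ1 S1
  -- Each edge needs the three directional derivatives in its own order; on U, where S is smooth,
  -- all orders equal -DS.
  have swap₁ : ∀ a b e : ℝ × ℝ, Set.EqOn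
      (TrilinearOsc.pd a (TrilinearOsc.pd b (TrilinearOsc.pd e S)))
      (TrilinearOsc.pd b (TrilinearOsc.pd a (TrilinearOsc.pd e S))) U := fun a b e =>
    TrilinearOsc.pd_comm hU (TrilinearOsc.pd_contDiffOn hU hS e) a b
  have swap₂ : ∀ a b e : ℝ × ℝ, Set.EqOn
      (TrilinearOsc.pd a (TrilinearOsc.pd b (TrilinearOsc.pd e S)))
      (TrilinearOsc.pd a (TrilinearOsc.pd e (TrilinearOsc.pd b S))) U := fun a b e =>
    TrilinearOsc.pd_congr hU (TrilinearOsc.pd_comm hU hS b e) a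
  have hD : Set.EqOn (TrilinearOsc.pd (1, 0) (TrilinearOsc.pd (0, 1) (TrilinearOsc.pd (-1, 1) S)))
      (fun z => -TrilinearOsc.D S z) U := fun z _ => by
    rw [TrilinearOsc.D_eq_neg]; exact (neg_neg _).symm
  have hvwu := ((swap₂ (0, 1) (-1, 1) (1, 0)).trans (swap₁ (0, 1) (1, 0) (-1, 1))).trans hD
  have hwvu := (swap₁ (-1, 1) (0, 1) (1, 0)).trans hvwu
  have huwv := (swap₂ (1, 0) (-1, 1) (0, 1)).trans hD
  have d1 := HM δ₁ μ hδ₁ hμ φ hφ (1, 0) (-1, 1) (0, 1) wx (fun z => (φ1 z).1) (fun z => (φ2 z).1)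
    U _ S hU hS hTH hHU cw cv hwvu (fun z hz => (hDS z hz).1) (fun z hz => (S1 z hz).1)
    (fun z hz => (S2 z hz).1) lam hlam
  have d2 := HM δ₁ μ hδ₁ hμ φ hφ (1, 0) (0, 1) (-1, 1) wx (fun z => (φ1 z).1) (fun z => (φ2 z).1)
    U _ S hU hS hTH hHU cv cw hvwu (fun z hz => (hDS z hz).1) (fun z hz => (S1 z hz).1)
    (fun z hz => (S2 z hz).1) lam hlam
  have d3 := HM δ₂ μ hδ₂ hμ φ hφ (0, 1) (1, 0) (-1, 1) wy (fun z => (φ1 z).2) (fun z => (φ2 z).2)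
    U _ S hU hS hTH hHU cu cw huwv (fun z hz => (hDS z hz).1) (fun z hz => (S1 z hz).2)
    (fun z hz => (S2 z hz).2) lam hlam
  have hσ : TrilinearOsc.BddKernel (TrilinearOsc.oscKernel lam S φ) :=
    TrilinearOsc.bddKernel_oscKernel hU hS.continuousOn hφ.continuous (hTH.trans hHU) hφc
  have two_le : ∀ {x : ℝ}, 2 ≤ x → (2 : ENNReal) ≤ ENNReal.ofReal x := fun {x} hx => by
    rw [show (2 : ENNReal) = ENNReal.ofReal 2 by simp]; exact ENNReal.ofReal_le_ofReal hx
  have main := hσ.integrable_and_bound (K := C * (M / (|lam| * μ)) ^ (1 / 4 : ℝ)) (by positivity)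
    (two_le hp) (two_le hq) (two_le hr) ENNReal.ofReal_ne_top ENNReal.ofReal_ne_top
    ENNReal.ofReal_ne_top
    (HC _ hσ M (|lam| * μ) δ₁ δ₂ hM (by positivity) hδ₁ hδ₂ d1 d2 d3) hf hg hh
  have e : TrilinearOsc.integrand lam S φ f g h = fun z : ℝ × ℝ =>
      TrilinearOsc.oscKernel lam S φ z * (f z.1 * g z.2 * h (z.1 + z.2)) := by
    ext z
    simp only [TrilinearOsc.integrand, TrilinearOsc.oscKernel]
    ring
  refine ⟨e ▸ main.1, ?_⟩
  -- The decay rate N = |λ|μ enters the edge bounds as (M/N)^{1/4}, which yields the power -1/4.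
  have hK : C * (M / (|lam| * μ)) ^ (1 / 4 : ℝ) =
      C * M ^ (1 / 4 : ℝ) * |lam * μ| ^ (-(1 / 4) : ℝ) := by
    rw [abs_mul, abs_of_pos hμ, Real.div_rpow hM.le (by positivity),
      Real.rpow_neg (by positivity), div_eq_mul_inv, mul_assoc]
  rw [← hK, TrilinearOsc.form, e]
  exact main.2
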